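/- Let $r\ge 0$ and let $\Gamma=\langle s_1,\dots,s_r\rangle$ be the free group of rank $r$, with word metric given by $s_1,\dots,s_r$ and balls $B(n)$ of radius $n$ about the identity. *Definitions.* Let $\gamma$ be a measure-preserving action of $\Gamma$ on a standard probability space $(Y,\mathcal B,m)$. For a countable measurable partition $\mathcal P$ of $Y$ put $H_m(\mathcal P)=-\sum_{P\in\mathcal P}m(P)\log m(P)\in[0,\infty]$ (with $0\log 0=0$), and for finite $W\subset\Gamma$ put $\mathcal P^W=\bigvee_{w\in W}\gamma_w\mathcal P$. If $H_m(\mathcal P)<\infty$, let $$F_m(\gamma,\mathcal P)=(1-2r)H_m(\mathcal P)+\sum_{i=1}^r H_m(\mathcal P\vee\gamma_{s_i}\mathcal P),\qquad f_m(\gamma,\mathcal P)=\inf_{n>0}F_m\bigl(\gamma,\mathcal P^{B(n)}\bigr)\in[-\infty,\infty).$$ The partition $\mathcal P$ is generating for $\gamma$ if the smallest $\gamma(\Gamma)$-invariant $\sigma$-algebra containing $\mathcal P$ is $\mathcal B$ up to sets of measure zero. The $f$-invariant $f_m(\gamma)$ is defined if there is a finite-entropy generating partition for $\gamma$, and is then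 the common value of $f_m(\gamma,\mathcal P)$ over all finite-entropy generating partitions $\mathcal P$. *Theorem.* Let $\alpha$ be a measure-preserving action of $\Gamma$ on a standard probability space $(X,\mathcal B_X,\nu)$ that has a finite-entropy generating partition. Let $G$ be a compact metrizable totally disconnected group with Haar probability measure $\mu$, and let $\beta$ be an action of $\Gamma$ on $G$ by (continuous) group automorphisms. Let $\sigma:\Gamma\times X\to G$ be a cocycle, i.e. a measurable map with $$\sigma(gh,x)=\beta_g(\sigma(h,x))\cdot\sigma(g,\alpha_h x)\qquad(g,h\in\Gamma,\ x\in X),$$ and let $\alpha\times_\sigma\beta$ be the skew-product action $(\alpha\times_\sigma\beta)_g(x,y)=(\alpha_g x,\ \beta_g(y)\cdot\sigma(g,x))$ of $\Gamma$ on $(X\times G,\nu\times\mu)$. Suppose that there is a finite-index clopen normal subgroup $N\lhd G$ such that $\{gN: g\in G\}$ is a generating partition for $\beta$. Then $f_\nu(\alpha)$, $f_\mu(\beta)$ and $f_{\nu\times\mu}(\alpha\times_\sigma\beta)$ are defined, and $$f_{\nu\times\mu}(\alpha\times_\sigma\beta)=f_\nu(\alpha)+f_\mu(\beta).$$ -/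

import Mathlib

open MeasureTheory
open scoped ENNReal

noncomputable section

namespace FInvariant

/-! A countable partition of `X` is given by a labelling `P : X → ι` with `ι` countable: the cells are
the fibres `P ⁻¹' {i}`, and empty cells are harmless.  An action of `Γ` on `X` is a homomorphism
`Γ →* Equiv.Perm X`. -/

/-- Shannon entropy `-∑ ν(P) log ν(P)` of a partition; each term is nonnegative for a
probability measure, and the value `∞` is allowed. -/
def entropy {X ι : Type*} [MeasurableSpace X] (ν : Measure X) (P : X → ι) : ℝ≥0∞ :=
  ∑' i, ENNReal.ofReal (Real.negMulLog (ν.real (P ⁻¹' {i})))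

/-- The join `P ∨ Q`. -/
def join {X ι κ : Type*} (P : X → ι) (Q : X → κ) : X → ι × κ :=
  fun x => (P x, Q x)

/-- The partition `α_g P`, with cells `α_g (P ⁻¹' {i})`. -/
def translate {Γ X ι : Type*} [Group Γ] (α : Γ →* Equiv.Perm X) (g : Γ) (P : X → ι) : X → ι :=
  fun x => P ((α g).symm x)

/-- The partition `P^W = ⋁_{w ∈ W} α_w P`. -/
def joinOver {Γ X ι : Type*} [Group Γ] (α : Γ →* Equiv.Perm X) (W : Set Γ) (P : X → ι) :
    X → (W → ι) :=
  fun x w => translate α (w : Γ) P x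

/-- The ball of radius `n` about the identity for the word metric of the free group. -/
def ball (r n : ℕ) : Set (FreeGroup (Fin r)) :=
  {g | g.norm ≤ n}

/-- `F_ν(α, P) = (1 - 2r) H(P) + ∑ᵢ H(P ∨ α_{sᵢ} P)`, used for `P` of finite entropy. -/
def bigF {r : ℕ} {X ι : Type*} [MeasurableSpace X] (α : FreeGroup (Fin r) →* Equiv.Perm X)
    (ν : Measure X) (P : X → ι) : ℝ :=
  (1 - 2 * (r : ℝ)) * (entropy ν P).toReal +
    ∑ i : Fin r, (entropy ν (join P (translate α (FreeGroup.of i) P))).toReal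

/-- `f_ν(α, P) = inf_{n > 0} F_ν(α, P^{B(n)})`, possibly `-∞`. -/
def smallF {r : ℕ} {X ι : Type*} [MeasurableSpace X] (α : FreeGroup (Fin r) →* Equiv.Perm X)
    (ν : Measure X) (P : X → ι) : EReal :=
  ⨅ (n : ℕ) (_ : 0 < n), (bigF α ν (joinOver α (ball r n) P) : EReal)

/-- The smallest `α(Γ)`-invariant σ-algebra containing the cells of `P`. -/
def invariantSigma {Γ X ι : Type*} [Group Γ] (α : Γ →* Equiv.Perm X) (P : X → ι) :
    MeasurableSpace X :=
  sInf {m | (∀ g s, MeasurableSet[m] s → MeasurableSet[m] (α g '' s)) ∧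
    ∀ i, MeasurableSet[m] (P ⁻¹' {i})}

/-- `P` is a measurable partition which is generating for `α`: the smallest invariant σ-algebra
containing `P` is the whole σ-algebra up to null sets. -/
structure IsGenerating {Γ X ι : Type*} [Group Γ] [MeasurableSpace X] (α : Γ →* Equiv.Perm X)
    (ν : Measure X) (P : X → ι) : Prop where
  measurableSet_cell : ∀ i, MeasurableSet (P ⁻¹' {i})
  exists_ae_eq : ∀ s, MeasurableSet s → ∃ t, MeasurableSet[invariantSigma α P] t ∧ t =ᵐ[ν] s

/-- `P` is a finite-entropy generating (countable) partition for `α`. -/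
def IsFiniteEntropyGenerator {Γ X : Type*} [Group Γ] [MeasurableSpace X] (α : Γ →* Equiv.Perm X)
    (ν : Measure X) (P : X → ℕ) : Prop :=
  IsGenerating α ν P ∧ entropy ν P ≠ ∞

/-- The `f`-invariant of `α` is defined and equals `a`: a finite-entropy generating partition
exists, and any such partition `P` has `f_ν(α, P) = a`. -/
def HasFInvariant {r : ℕ} {X : Type*} [MeasurableSpace X] (α : FreeGroup (Fin r) →* Equiv.Perm X)
    (ν : Measure X) (a : EReal) : Prop :=
  (∃ P : X → ℕ, IsFiniteEntropyGenerator α ν P) ∧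
    ∀ P : X → ℕ, IsFiniteEntropyGenerator α ν P → smallF α ν P = a

/-- The permutation action underlying an action by group automorphisms. -/
def autAction {Γ G : Type*} [Group Γ] [Group G] (β : Γ →* MulAut G) : Γ →* Equiv.Perm G :=
  (MulAut.toPerm G).comp β

/-- `σ : Γ × X → G` is a (measurable) cocycle for `α` and `β`. -/
structure IsCocycle {Γ X G : Type*} [Group Γ] [Group G] [MeasurableSpace X] [MeasurableSpace G]
    (α : Γ →* Equiv.Perm X) (β : Γ →* MulAut G) (σ : Γ → X → G) : Prop where
  measurable : ∀ g, Measurable (σ g)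
  map_mul : ∀ g h x, σ (g * h) x = β g (σ h x) * σ g (α h x)

theorem IsCocycle.map_one {Γ X G : Type*} [Group Γ] [Group G] [MeasurableSpace X]
    [MeasurableSpace G] {α : Γ →* Equiv.Perm X} {β : Γ →* MulAut G} {σ : Γ → X → G}
    (hσ : IsCocycle α β σ) (x : X) : σ 1 x = 1 := by
  have h := hσ.map_mul 1 1 x
  simpa using h

/-- The skew-product action `(α ×_σ β)_g (x, y) = (α_g x, β_g y · σ(g, x))`. -/
def skewProduct {Γ X G : Type*} [Group Γ] [Group G] [MeasurableSpace X] [MeasurableSpace G]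
    (α : Γ →* Equiv.Perm X) (β : Γ →* MulAut G) (σ : Γ → X → G) (hσ : IsCocycle α β σ) :
    Γ →* Equiv.Perm (X × G) :=
  MonoidHom.toHomPerm
    { toFun := fun g p => (α g p.1, β g p.2 * σ g p.1)
      map_one' := by
        funext p
        simp [hσ.map_one]
        rfl
      map_mul' := by
        intro g h
        funext p
        change _ = (α g (α h p.1), β g (β h p.2 * σ h p.1) * σ g (α h p.1))
        simp [hσ.map_mul, mul_assoc] }

theorem skewProduct_apply {Γ X G : Type*} [Group Γ] [Group G] [MeasurableSpace X]
    [MeasurableSpace G] (α : Γ →* Equiv.Perm X) (β : Γ →* MulAut G) (σ : Γ → X → G)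
    (hσ : IsCocycle α β σ) (g : Γ) (x : X) (y : G) :
    skewProduct α β σ hσ g (x, y) = (α g x, β g y * σ g x) :=
  rfl

end FInvariant

end

noncomputable section

namespace FInvariant

open Filter Topology Function

/-! Write `q` for the partition of `G` into cosets of `N`, and `γ` for the skew product. Since `N`
is normal, the `γ`-translates of the lifted `q` over a finite window `W` are the `β`-translates
multiplied, in `G ⧸ N`, by the cosets `c` of finitely many cocycle values. So `c` is a finite
partition of the base. Once `c` is known, the twisted and untwisted fibre partitions determine each
other, and the untwisted one is independent of the base. For a base partition `A` this places H(A ∨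
twisted fibre) between H(A) + H(q^W) and the same plus H(c | A) (`shannon_skewProduct_bounds`).

If `P` generates `α`, then H(c | P^{B(k)}) → 0 (`tendsto_relShannon_joinOver`), so for fixed n,
F(P^{B(k)} ∨ q^{B(n)}) − F(P^{B(k)}) → F(q^{B(n)}) as k → ∞, the last term being taken for `β`. The
other ingredient is monotonicity: F does not increase when a ball in either factor grows
(`bigF_splitting`). Hence the infimum over the diagonal k = n is an iterated infimum. Taking k → ∞
and then n → ∞ gives the sum, also when a value is −∞.

The same two facts show that f is independent of the generator: both f(P) and f(Q) equal the double
infimum of F(P^{B(k)} ∨ Q^{B(n)}). -/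

theorem join_preimage_singleton {X ι κ : Type*} (P : X → ι) (Q : X → κ) (a : ι × κ) :
    join P Q ⁻¹' {a} = P ⁻¹' {a.1} ∩ Q ⁻¹' {a.2} := by
  ext x
  simp [join, Prod.ext_iff]

/-! ### Extended-valued Shannon entropy: chain rule, Jensen, independence. -/

section Entropy

variable {X Y ι κ τ : Type*} [MeasurableSpace X] [MeasurableSpace Y]

theorem measurableSet_preimage_of_cells [Countable ι] {P : X → ι}
    (hP : ∀ i, MeasurableSet (P ⁻¹' {i})) (T : Set ι) : MeasurableSet (P ⁻¹' T) := by
  rw [← Set.biUnion_preimage_singleton]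
  exact MeasurableSet.biUnion (Set.to_countable T) fun i _ => hP i

theorem measurableSet_join_cell {P : X → ι} {Q : X → κ} (hP : ∀ i, MeasurableSet (P ⁻¹' {i}))
    (hQ : ∀ i, MeasurableSet (Q ⁻¹' {i})) (a : ι × κ) : MeasurableSet (join P Q ⁻¹' {a}) := by
  rw [join_preimage_singleton]
  exact (hP _).inter (hQ _)

theorem tsum_measure_inter_cell [Countable ι] (ν : Measure X) {P : X → ι}
    (hP : ∀ i, MeasurableSet (P ⁻¹' {i})) {s : Set X} (hs : MeasurableSet s) :
    ∑' i, ν (s ∩ P ⁻¹' {i}) = ν s := by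
  rw [← measure_iUnion _ fun i => hs.inter (hP i)]
  · congr 1
    ext x
    simp
  · intro i j hij
    refine Set.disjoint_left.2 fun x hx hx' => hij ?_
    rw [← hx.2, ← hx'.2]

theorem hasSum_measureReal_inter_cell [Countable ι] (ν : Measure X) [IsFiniteMeasure ν]
    {P : X → ι} (hP : ∀ i, MeasurableSet (P ⁻¹' {i})) {s : Set X} (hs : MeasurableSet s) :
    HasSum (fun i => ν.real (s ∩ P ⁻¹' {i})) (ν.real s) := by
  have h := tsum_measure_inter_cell ν hP hs
  have h2 := ENNReal.hasSum_toReal (f := fun i => ν (s ∩ P ⁻¹' {i})) (by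
    rw [h]; exact measure_ne_top _ _)
  rw [← ENNReal.tsum_toReal_eq (fun _ => measure_ne_top _ _), h] at h2
  exact h2

/-- The contribution `m(p) η(m(q ∩ p) / m(p))` of a pair of cells to a conditional entropy. -/
def condTerm (ν : Measure X) (p q : Set X) : ℝ :=
  ν.real p * Real.negMulLog (ν.real (p ∩ q) / ν.real p)

/-- The conditional Shannon entropy `H(Q | P)`. -/
def condEntropy (ν : Measure X) (P : X → ι) (Q : X → κ) : ℝ≥0∞ :=
  ∑' i, ∑' j, ENNReal.ofReal (condTerm ν (P ⁻¹' {i}) (Q ⁻¹' {j}))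

theorem condTerm_nonneg (ν : Measure X) [IsFiniteMeasure ν] (p q : Set X) :
    0 ≤ condTerm ν p q :=
  mul_nonneg measureReal_nonneg (Real.negMulLog_nonneg (by positivity)
    (div_le_one_of_le₀ (measureReal_mono Set.inter_subset_left) measureReal_nonneg))

/-- The chain rule on one pair of cells: η(ab) = bη(a) + aη(b) with a = ν(p) and b = ν(p ∩ q)/ν(p).
If p is null, all terms vanish. -/
theorem negMulLog_measureReal_inter (ν : Measure X) [IsFiniteMeasure ν] (p q : Set X) :
    Real.negMulLog (ν.real (p ∩ q)) =
      ν.real (p ∩ q) * -Real.log (ν.real p) + condTerm ν p q := by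
  rcases eq_or_ne (ν.real p) 0 with h | h
  · have h' : ν.real (p ∩ q) = 0 :=
      le_antisymm (h ▸ measureReal_mono Set.inter_subset_left) measureReal_nonneg
    simp [h, h', condTerm]
  · conv_lhs => rw [← mul_div_cancel₀ (ν.real (p ∩ q)) h, Real.negMulLog_mul]
    rw [condTerm, Real.negMulLog, Real.negMulLog]
    field_simp

theorem tsum_negMulLog_inter [Countable ι] (ν : Measure X) [IsProbabilityMeasure ν]
    {Q : X → ι} (hQ : ∀ i, MeasurableSet (Q ⁻¹' {i})) {p : Set X} (hp : MeasurableSet p) :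
    ∑' j, ENNReal.ofReal (Real.negMulLog (ν.real (p ∩ Q ⁻¹' {j}))) =
      ENNReal.ofReal (Real.negMulLog (ν.real p)) +
        ∑' j, ENNReal.ofReal (condTerm ν p (Q ⁻¹' {j})) := by
  have hlog : 0 ≤ -Real.log (ν.real p) :=
    neg_nonneg.2 (Real.log_nonpos measureReal_nonneg measureReal_le_one)
  have h1 : ∀ j, ENNReal.ofReal (Real.negMulLog (ν.real (p ∩ Q ⁻¹' {j}))) =
      ENNReal.ofReal (ν.real (p ∩ Q ⁻¹' {j}) * -Real.log (ν.real p)) +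
        ENNReal.ofReal (condTerm ν p (Q ⁻¹' {j})) := fun j => by
    rw [negMulLog_measureReal_inter, ENNReal.ofReal_add (mul_nonneg measureReal_nonneg hlog)
      (condTerm_nonneg _ _ _)]
  have hs := (hasSum_measureReal_inter_cell ν hQ hp).mul_right (-Real.log (ν.real p))
  simp_rw [h1]
  rw [ENNReal.tsum_add, ← ENNReal.ofReal_tsum_of_nonneg
    (fun j => mul_nonneg measureReal_nonneg hlog) hs.summable, hs.tsum_eq]
  simp [Real.negMulLog]

theorem entropy_join [Countable κ] (ν : Measure X) [IsProbabilityMeasure ν] {P : X → ι} {Q : X → κ}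
    (hP : ∀ i, MeasurableSet (P ⁻¹' {i})) (hQ : ∀ i, MeasurableSet (Q ⁻¹' {i})) :
    entropy ν (join P Q) = entropy ν P + condEntropy ν P Q := by
  rw [entropy, ENNReal.tsum_prod', entropy, condEntropy, ← ENNReal.tsum_add]
  refine tsum_congr fun i => ?_
  simp_rw [join_preimage_singleton]
  exact tsum_negMulLog_inter ν hQ (hP i)

/-- Concavity: η lies below its tangent line at t. Applied at the average t, this yields Jensen's
inequality with both sides linear and hence summable. -/
theorem negMulLog_le_tangent {x t : ℝ} (hx : 0 ≤ x) (ht : 0 < t) :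
    Real.negMulLog x ≤ -(x * Real.log t) + t - x := by
  rcases hx.eq_or_lt with rfl | hx
  · simpa using ht.le
  · have h := Real.log_le_sub_one_of_pos (div_pos ht hx)
    rw [Real.log_div ht.ne' hx.ne'] at h
    have h2 := mul_le_mul_of_nonneg_left h hx.le
    have h3 : x * (t / x - 1) = t - x := by field_simp
    rw [Real.negMulLog]
    linarith

/-- Jensen's inequality for the contribution of a pair of cells. -/
theorem tsum_condTerm_inter_le [Countable ι] (ν : Measure X) [IsFiniteMeasure ν]
    {R : X → ι} (hR : ∀ i, MeasurableSet (R ⁻¹' {i})) {p q : Set X} (hp : MeasurableSet p)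
    (hq : MeasurableSet q) :
    ∑' k, ENNReal.ofReal (condTerm ν (p ∩ R ⁻¹' {k}) q) ≤ ENNReal.ofReal (condTerm ν p q) := by
  rcases eq_or_ne (ν.real (p ∩ q)) 0 with h0 | h0
  · have : ∀ k, condTerm ν (p ∩ R ⁻¹' {k}) q = 0 := fun k => by
      have : ν.real (p ∩ R ⁻¹' {k} ∩ q) = 0 :=
        le_antisymm (h0 ▸ measureReal_mono
          (Set.inter_subset_inter_left _ Set.inter_subset_left)) measureReal_nonneg
      simp [condTerm, this]
    simp [this]
  have hp0 : 0 < ν.real p := (measureReal_nonneg.lt_of_ne' h0).trans_le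
    (measureReal_mono Set.inter_subset_left)
  set t := ν.real (p ∩ q) / ν.real p with ht
  have htpos : 0 < t := div_pos (measureReal_nonneg.lt_of_ne' h0) hp0
  have hle : ∀ k, condTerm ν (p ∩ R ⁻¹' {k}) q ≤
      ν.real (p ∩ q ∩ R ⁻¹' {k}) * (-Real.log t - 1) + ν.real (p ∩ R ⁻¹' {k}) * t := fun k => by
    rw [condTerm, Set.inter_right_comm]
    rcases eq_or_ne (ν.real (p ∩ R ⁻¹' {k})) 0 with h | h
    · have h' : ν.real (p ∩ q ∩ R ⁻¹' {k}) = 0 :=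
        le_antisymm (h ▸ measureReal_mono
          (Set.inter_subset_inter_left _ Set.inter_subset_left)) measureReal_nonneg
      simp [h, h']
    · have := mul_le_mul_of_nonneg_left (negMulLog_le_tangent
        (x := ν.real (p ∩ q ∩ R ⁻¹' {k}) / ν.real (p ∩ R ⁻¹' {k})) (by positivity) htpos)
        (measureReal_nonneg (μ := ν) (s := p ∩ R ⁻¹' {k}))
      refine this.trans_eq ?_
      field_simp
      ring
  have hs := ((hasSum_measureReal_inter_cell ν hR (hp.inter hq)).mul_right
    (-Real.log t - 1)).add ((hasSum_measureReal_inter_cell ν hR hp).mul_right t)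
  calc _ ≤ ∑' k, ENNReal.ofReal
        (ν.real (p ∩ q ∩ R ⁻¹' {k}) * (-Real.log t - 1) + ν.real (p ∩ R ⁻¹' {k}) * t) :=
        ENNReal.tsum_le_tsum fun k => ENNReal.ofReal_le_ofReal (hle k)
    _ = ENNReal.ofReal (ν.real (p ∩ q) * (-Real.log t - 1) + ν.real p * t) := by
        rw [← ENNReal.ofReal_tsum_of_nonneg
          (fun k => (condTerm_nonneg _ _ _).trans (hle k)) hs.summable, hs.tsum_eq]
    _ = _ := by
        congr 1
        rw [condTerm, ← ht, Real.negMulLog, ht]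
        field_simp
        ring

theorem condEntropy_join_le [Countable ι] [Countable τ] (ν : Measure X) [IsFiniteMeasure ν]
    {P : X → ι} {Q : X → κ} {R : X → τ}
    (hP : ∀ i, MeasurableSet (P ⁻¹' {i})) (hQ : ∀ i, MeasurableSet (Q ⁻¹' {i}))
    (hR : ∀ i, MeasurableSet (R ⁻¹' {i})) :
    condEntropy ν (join P R) Q ≤ condEntropy ν P Q := by
  rw [condEntropy, ENNReal.tsum_prod', condEntropy]
  refine ENNReal.tsum_le_tsum fun i => ?_
  rw [ENNReal.tsum_comm]
  refine ENNReal.tsum_le_tsum fun j => ?_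
  simp_rw [join_preimage_singleton]
  exact tsum_condTerm_inter_le ν hR (hP i) (hQ j)

/-- Labels outside the range of `f` have empty cells, which contribute η(0) = 0. -/
theorem entropy_comp_injective (ν : Measure X) (P : X → ι) {f : ι → κ} (hf : Injective f) :
    entropy ν (f ∘ P) = entropy ν P := by
  rw [entropy, entropy, ← hf.tsum_eq]
  · refine tsum_congr fun i => ?_
    congr 3
    ext x
    simp [hf.eq_iff]
  · intro k hk
    by_contra hk'
    apply hk
    have : f ∘ P ⁻¹' {k} = ∅ := by
      ext x
      simp only [Set.mem_preimage, comp_apply, Set.mem_singleton_iff, Set.mem_empty_iff_false,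
        iff_false]
      rintro rfl
      exact hk' ⟨_, rfl⟩
    simp [this]

theorem entropy_comp_measurePreserving {ν : Measure X} {m : Measure Y} {φ : X → Y}
    (hφ : MeasurePreserving φ ν m) {P : Y → ι} (hP : ∀ i, MeasurableSet (P ⁻¹' {i})) :
    entropy ν (P ∘ φ) = entropy m P := by
  refine tsum_congr fun i => ?_
  rw [Set.preimage_comp, measureReal_def, hφ.measure_preimage (hP i).nullMeasurableSet,
    measureReal_def]

theorem entropy_of_subsingleton [Subsingleton ι] (ν : Measure X) [IsProbabilityMeasure ν]
    (P : X → ι) : entropy ν P = 0 := by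
  refine ENNReal.tsum_eq_zero.2 fun i => ?_
  have : P ⁻¹' {i} = Set.univ := by
    ext x
    simp [Subsingleton.elim (P x) i]
  simp [this]

theorem entropy_ne_top_of_finite [Finite ι] (ν : Measure X) (P : X → ι) : entropy ν P ≠ ∞ := by
  cases nonempty_fintype ι
  rw [entropy, tsum_fintype]
  exact ENNReal.sum_ne_top.2 fun _ _ => ENNReal.ofReal_ne_top

/-- `P.FactorsThrough Q` expresses that Q refines P. Then P ∨ Q is an injective relabelling of Q,
and the chain rule gives H(Q) = H(P) + H(Q | P). -/
theorem entropy_le_of_factorsThrough [Countable ι] [Countable κ] (ν : Measure X)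
    [IsProbabilityMeasure ν] {P : X → ι} {Q : X → κ} (hP : ∀ i, MeasurableSet (P ⁻¹' {i}))
    (hQ : ∀ i, MeasurableSet (Q ⁻¹' {i})) (h : P.FactorsThrough Q) :
    entropy ν P ≤ entropy ν Q := by
  have : Nonempty ι := (nonempty_of_isProbabilityMeasure ν).map P
  obtain ⟨f, hf⟩ := (factorsThrough_iff P).1 h
  have h1 : join P Q = (fun k => (f k, k)) ∘ Q := by
    rw [hf]
    rfl
  have h2 := entropy_join ν hP hQ
  rw [h1, entropy_comp_injective ν Q fun a b hab => (Prod.ext_iff.1 hab).2] at h2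
  rw [h2]
  exact le_self_add

theorem tsum_condTerm_le_negMulLog [Countable ι] (ν : Measure X) [IsProbabilityMeasure ν]
    {P : X → ι} (hP : ∀ i, MeasurableSet (P ⁻¹' {i})) {q : Set X} (hq : MeasurableSet q) :
    ∑' i, ENNReal.ofReal (condTerm ν (P ⁻¹' {i}) q) ≤
      ENNReal.ofReal (Real.negMulLog (ν.real q)) := by
  have := tsum_condTerm_inter_le ν hP MeasurableSet.univ hq
  simp only [Set.univ_inter] at this
  simpa only [condTerm, Set.univ_inter, probReal_univ, one_mul, div_one] using this

theorem condEntropy_le_entropy [Countable ι] [Countable κ] (ν : Measure X) [IsProbabilityMeasure ν]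
    {P : X → ι} {Q : X → κ} (hP : ∀ i, MeasurableSet (P ⁻¹' {i}))
    (hQ : ∀ i, MeasurableSet (Q ⁻¹' {i})) : condEntropy ν P Q ≤ entropy ν Q := by
  rw [condEntropy, ENNReal.tsum_comm, entropy]
  exact ENNReal.tsum_le_tsum fun j => tsum_condTerm_le_negMulLog ν hP (hQ j)

/-- The entropy of a pair of independent partitions. -/
theorem entropy_prod [Countable ι] [Countable κ] (ν : Measure X) [IsProbabilityMeasure ν]
    (m : Measure Y) [IsProbabilityMeasure m] {P : X → ι} {Q : Y → κ}
    (hP : ∀ i, MeasurableSet (P ⁻¹' {i})) (hQ : ∀ i, MeasurableSet (Q ⁻¹' {i})) :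
    entropy (ν.prod m) (join (P ∘ Prod.fst) (Q ∘ Prod.snd)) = entropy ν P + entropy m Q := by
  have hc : ∀ a : ι × κ, join (P ∘ Prod.fst) (Q ∘ Prod.snd) ⁻¹' {a} =
      (P ⁻¹' {a.1}) ×ˢ (Q ⁻¹' {a.2}) := fun a => by
    rw [join_preimage_singleton]
    rfl
  have h1 : ∀ i j, ENNReal.ofReal (Real.negMulLog (ν.real (P ⁻¹' {i}) * m.real (Q ⁻¹' {j}))) =
      ENNReal.ofReal (Real.negMulLog (ν.real (P ⁻¹' {i}))) * m (Q ⁻¹' {j}) +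
      ν (P ⁻¹' {i}) * ENNReal.ofReal (Real.negMulLog (m.real (Q ⁻¹' {j}))) := fun i j => by
    have e1 := Real.negMulLog_nonneg (measureReal_nonneg (μ := ν) (s := P ⁻¹' {i}))
      measureReal_le_one
    have e2 := Real.negMulLog_nonneg (measureReal_nonneg (μ := m) (s := Q ⁻¹' {j}))
      measureReal_le_one
    rw [Real.negMulLog_mul, ENNReal.ofReal_add (mul_nonneg measureReal_nonneg e1)
      (mul_nonneg measureReal_nonneg e2), ENNReal.ofReal_mul measureReal_nonneg,
      ENNReal.ofReal_mul measureReal_nonneg, ofReal_measureReal, ofReal_measureReal, mul_comm]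
  rw [entropy, ENNReal.tsum_prod']
  simp_rw [hc, measureReal_prod_prod, h1, ENNReal.tsum_add, ENNReal.tsum_mul_left]
  rw [ENNReal.tsum_mul_right, ENNReal.tsum_mul_right]
  have e1 : ∑' i, ν (P ⁻¹' {i}) = 1 := by
    simpa using tsum_measure_inter_cell ν hP MeasurableSet.univ
  have e2 : ∑' i, m (Q ⁻¹' {i}) = 1 := by
    simpa using tsum_measure_inter_cell m hQ MeasurableSet.univ
  rw [e1, e2, mul_one, one_mul, entropy, entropy]

end Entropy

/-! ### Real-valued entropy calculus for partitions of finite entropy. -/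

section FiniteEntropy

variable {X Y ι κ τ : Type*} [MeasurableSpace X] [MeasurableSpace Y]

/-- A measurable partition of finite Shannon entropy. -/
structure FiniteEntropy (ν : Measure X) (P : X → ι) : Prop where
  cells : ∀ i, MeasurableSet (P ⁻¹' {i})
  ne_top : entropy ν P ≠ ∞

/-- Shannon entropy as a real number. -/
def shannon (ν : Measure X) (P : X → ι) : ℝ :=
  (entropy ν P).toReal

/-- The conditional entropy `H(Q | P)` as a real number. -/
def relShannon (ν : Measure X) (P : X → ι) (Q : X → κ) : ℝ :=
  shannon ν (join P Q) - shannon ν P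

variable [Countable ι] [Countable κ] [Countable τ]
  {ν : Measure X} [IsProbabilityMeasure ν]
  {P : X → ι} {Q : X → κ} {R : X → τ}

theorem FiniteEntropy.join (hP : FiniteEntropy ν P) (hQ : FiniteEntropy ν Q) :
    FiniteEntropy ν (join P Q) := by
  refine ⟨measurableSet_join_cell hP.cells hQ.cells, ?_⟩
  rw [entropy_join ν hP.cells hQ.cells]
  exact ENNReal.add_ne_top.2 ⟨hP.ne_top, ne_top_of_le_ne_top hQ.ne_top
    (condEntropy_le_entropy ν hP.cells hQ.cells)⟩

omit [Countable ι] [IsProbabilityMeasure ν] in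
theorem FiniteEntropy.comp_measurePreserving {m : Measure Y} {φ : Y → X}
    (hP : FiniteEntropy ν P) (hφ : MeasurePreserving φ m ν) : FiniteEntropy m (P ∘ φ) := by
  refine ⟨fun i => hφ.measurable (hP.cells i), ?_⟩
  rw [entropy_comp_measurePreserving hφ hP.cells]
  exact hP.ne_top

theorem FiniteEntropy.of_factorsThrough (hQ : FiniteEntropy ν Q) (h : P.FactorsThrough Q) :
    FiniteEntropy ν P := by
  have : Nonempty ι := (nonempty_of_isProbabilityMeasure ν).map P
  have hc : ∀ i, MeasurableSet (P ⁻¹' {i}) := by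
    obtain ⟨f, rfl⟩ := (factorsThrough_iff P).1 h
    exact fun i => measurableSet_preimage_of_cells hQ.cells (f ⁻¹' {i})
  exact ⟨hc, ne_top_of_le_ne_top hQ.ne_top (entropy_le_of_factorsThrough ν hc hQ.cells h)⟩

theorem shannon_mono (hQ : FiniteEntropy ν Q) (h : P.FactorsThrough Q) :
    shannon ν P ≤ shannon ν Q :=
  ENNReal.toReal_mono hQ.ne_top
    (entropy_le_of_factorsThrough ν (hQ.of_factorsThrough h).cells hQ.cells h)

theorem shannon_congr (hQ : FiniteEntropy ν Q) (h : P.FactorsThrough Q) (h' : Q.FactorsThrough P) :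
    shannon ν P = shannon ν Q :=
  (shannon_mono hQ h).antisymm (shannon_mono (hQ.of_factorsThrough h) h')

theorem relShannon_eq (hP : FiniteEntropy ν P) (hQ : FiniteEntropy ν Q) :
    relShannon ν P Q = (condEntropy ν P Q).toReal := by
  rw [relShannon, shannon, entropy_join ν hP.cells hQ.cells, ENNReal.toReal_add hP.ne_top
    (ne_top_of_le_ne_top hQ.ne_top (condEntropy_le_entropy ν hP.cells hQ.cells)), shannon]
  ring

theorem relShannon_nonneg (hP : FiniteEntropy ν P) (hQ : FiniteEntropy ν Q) :
    0 ≤ relShannon ν P Q := by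
  rw [relShannon_eq hP hQ]
  exact ENNReal.toReal_nonneg

/-- As R refines P, the joins P ∨ R and R are the same partition up to labels, so this is
`condEntropy_join_le`. -/
theorem relShannon_anti (hQ : FiniteEntropy ν Q) (hR : FiniteEntropy ν R)
    (h : P.FactorsThrough R) : relShannon ν R Q ≤ relShannon ν P Q := by
  have hP := hR.of_factorsThrough h
  have h1 : relShannon ν (join P R) Q ≤ relShannon ν P Q := by
    rw [relShannon_eq (hP.join hR) hQ, relShannon_eq hP hQ]
    exact ENNReal.toReal_mono (ne_top_of_le_ne_top hQ.ne_top
      (condEntropy_le_entropy ν hP.cells hQ.cells))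
      (condEntropy_join_le ν hP.cells hQ.cells hR.cells)
  have h2 : shannon ν (join P R) = shannon ν R := by
    refine shannon_congr hR (fun x y hxy => ?_) fun x y hxy => ?_
    · simp [join, hxy, h hxy]
    · simp_all [join]
  have h3 : shannon ν (join (join P R) Q) = shannon ν (join R Q) := by
    refine shannon_congr (hR.join hQ) (fun x y hxy => ?_) fun x y hxy => ?_
    · simp only [join, Prod.mk.injEq] at hxy ⊢
      exact ⟨⟨h hxy.1, hxy.1⟩, hxy.2⟩
    · simp_all [join]
  rwa [relShannon, h2, h3] at h1

theorem relShannon_eq_zero (hP : FiniteEntropy ν P) (h : Q.FactorsThrough P) :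
    relShannon ν P Q = 0 := by
  rw [relShannon, sub_eq_zero]
  refine shannon_congr hP (fun x y hxy => ?_) fun x y hxy => ?_
  · simp [join, hxy, h hxy]
  · simp_all [join]

omit [Countable ι] [IsProbabilityMeasure ν] in
theorem shannon_comp_measurePreserving {m : Measure Y} {φ : Y → X}
    (hP : FiniteEntropy ν P) (hφ : MeasurePreserving φ m ν) :
    shannon m (P ∘ φ) = shannon ν P := by
  rw [shannon, entropy_comp_measurePreserving hφ hP.cells, shannon]

end FiniteEntropy

/-! ### Translates and joins over windows, with refinement encoded by `FactorsThrough`. -/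

section Action

variable {Γ X ι κ τ : Type*} [Group Γ] (α : Γ →* Equiv.Perm X)

theorem translate_eq_comp (g : Γ) (P : X → ι) : translate α g P = P ∘ α g⁻¹ := by
  funext x
  simp [translate]

theorem translate_translate (g h : Γ) (P : X → ι) :
    translate α g (translate α h P) = translate α (g * h) P := by
  simp only [translate_eq_comp, mul_inv_rev, map_mul]
  rfl

theorem translate_one (P : X → ι) : translate α 1 P = P := by
  simp [translate_eq_comp]

theorem translate_join (g : Γ) (P : X → ι) (Q : X → κ) :
    translate α g (join P Q) = join (translate α g P) (translate α g Q) :=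
  rfl

theorem factorsThrough_translate {P : X → ι} {Q : X → κ} (h : P.FactorsThrough Q) (g : Γ) :
    (translate α g P).FactorsThrough (translate α g Q) :=
  h.comp_right _

theorem factorsThrough_joinOver {W : Set Γ} {w : Γ} (hw : w ∈ W) (P : X → ι) :
    (translate α w P).FactorsThrough (joinOver α W P) :=
  fun _ _ h => congrFun h ⟨w, hw⟩

theorem joinOver_factorsThrough {W : Set Γ} {P : X → ι} {R : X → κ}
    (h : ∀ w ∈ W, (translate α w P).FactorsThrough R) : (joinOver α W P).FactorsThrough R :=
  fun _ _ hxy => funext fun w => h w w.2 hxy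

theorem joinOver_mono {V W : Set Γ} (h : V ⊆ W) (P : X → ι) :
    (joinOver α V P).FactorsThrough (joinOver α W P) :=
  joinOver_factorsThrough α fun _ hw => factorsThrough_joinOver α (h hw) P

theorem join_factorsThrough {P : X → ι} {Q : X → κ} {R : X → τ} (hP : P.FactorsThrough R)
    (hQ : Q.FactorsThrough R) : (join P Q).FactorsThrough R :=
  fun _ _ h => Prod.ext (hP h) (hQ h)

theorem factorsThrough_join_left {P : X → ι} {R : X → κ} (h : P.FactorsThrough R) (Q : X → τ) :
    P.FactorsThrough (join R Q) :=
  fun _ _ hxy => h (Prod.ext_iff.1 hxy).1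

theorem factorsThrough_join_right {P : X → ι} {R : X → κ} (h : P.FactorsThrough R) (Q : X → τ) :
    P.FactorsThrough (join Q R) :=
  fun _ _ hxy => h (Prod.ext_iff.1 hxy).2

variable [MeasurableSpace X] {ν : Measure X} [IsProbabilityMeasure ν]
  {α} (hα : ∀ g, MeasurePreserving (α g) ν ν)

include hα

omit [IsProbabilityMeasure ν] in
theorem FiniteEntropy.translate {P : X → ι} (hP : FiniteEntropy ν P) (g : Γ) :
    FiniteEntropy ν (translate α g P) := by
  rw [translate_eq_comp]
  exact hP.comp_measurePreserving (hα _)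

omit [IsProbabilityMeasure ν] in
theorem shannon_translate {P : X → ι} (hP : FiniteEntropy ν P) (g : Γ) :
    shannon ν (FInvariant.translate α g P) = shannon ν P := by
  rw [translate_eq_comp]
  exact shannon_comp_measurePreserving hP (hα _)

theorem relShannon_translate [Countable ι] [Countable κ] {P : X → ι} {Q : X → κ}
    (hP : FiniteEntropy ν P) (hQ : FiniteEntropy ν Q) (g : Γ) :
    relShannon ν (FInvariant.translate α g P) (FInvariant.translate α g Q) =
      relShannon ν P Q := by
  rw [relShannon, ← translate_join, shannon_translate hα (hP.join hQ), shannon_translate hα hP,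
    relShannon]

theorem FiniteEntropy.joinOver [Countable ι] {P : X → ι} (hP : FiniteEntropy ν P) {W : Set Γ}
    (hW : W.Finite) : FiniteEntropy ν (joinOver α W P) := by
  induction W, hW using Set.Finite.induction_on with
  | empty =>
    refine ⟨fun i => ?_, by rw [entropy_of_subsingleton]; simp⟩
    convert MeasurableSet.univ
    ext x
    simp [Subsingleton.elim (FInvariant.joinOver α ∅ P x) i]
  | @insert g W _ hW ih =>
    have := hW.to_subtype
    have := (hW.insert g).to_subtype
    refine ((hP.translate hα g).join ih).of_factorsThrough (joinOver_factorsThrough α ?_)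
    rintro w (rfl | hw)
    · exact factorsThrough_join_left .rfl _
    · exact factorsThrough_join_right (factorsThrough_joinOver α hw P) _

end Action

/-! ### Behaviour of F under refinement, and its monotonicity along balls. -/

section BigF

variable {r : ℕ} {X ι κ : Type*} [MeasurableSpace X] {ν : Measure X} [IsProbabilityMeasure ν]
  {α : FreeGroup (Fin r) →* Equiv.Perm X} (hα : ∀ g, MeasurePreserving (α g) ν ν)
  [Countable ι] [Countable κ]

omit [Countable ι] [IsProbabilityMeasure ν] in
theorem bigF_eq (P : X → ι) : bigF α ν P = (1 - 2 * (r : ℝ)) * shannon ν P +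
    ∑ i : Fin r, shannon ν (join P (translate α (FreeGroup.of i) P)) :=
  rfl

include hα

theorem bigF_congr {P : X → ι} {Q : X → κ} (hQ : FiniteEntropy ν Q) (h : P.FactorsThrough Q)
    (h' : Q.FactorsThrough P) : bigF α ν P = bigF α ν Q := by
  rw [bigF_eq, bigF_eq, shannon_congr hQ h h']
  congr 1
  refine Finset.sum_congr rfl fun i _ => shannon_congr (hQ.join (hQ.translate hα _)) ?_ ?_
  · exact join_factorsThrough (factorsThrough_join_left h _)
      (factorsThrough_join_right (factorsThrough_translate α h _) _)
  · exact join_factorsThrough (factorsThrough_join_left h' _)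
      (factorsThrough_join_right (factorsThrough_translate α h' _) _)

/-- Increment of the two-sided joins when `R` is refined by `Q`. -/
theorem shannon_join_translate_join {R : X → ι} {Q : X → κ} (hR : FiniteEntropy ν R)
    (hQ : FiniteEntropy ν Q) (g : FreeGroup (Fin r)) :
    shannon ν (join (join R Q) (translate α g (join R Q))) =
      shannon ν (join R (translate α g R)) + relShannon ν (join R (translate α g R)) Q +
        relShannon ν (join (join R (translate α g R)) Q) (translate α g Q) := by
  have h : shannon ν (join (join R Q) (translate α g (join R Q))) =
      shannon ν (join (join (join R (translate α g R)) Q) (translate α g Q)) := by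
    refine shannon_congr (((hR.join (hR.translate hα g)).join hQ).join (hQ.translate hα g))
      (fun x y hxy => ?_) fun x y hxy => ?_ <;>
    · simp only [translate_join, join, Prod.mk.injEq] at hxy ⊢
      tauto
  rw [h, relShannon, relShannon]
  ring

theorem relShannon_join_le {R : X → ι} {Q : X → κ} (hR : FiniteEntropy ν R)
    (hQ : FiniteEntropy ν Q) (g : FreeGroup (Fin r)) :
    relShannon ν (join R (translate α g R)) Q ≤ relShannon ν R Q :=
  relShannon_anti hQ (hR.join (hR.translate hα g)) (factorsThrough_join_left .rfl _)

theorem relShannon_join_join_le {R : X → ι} {Q : X → κ} (hR : FiniteEntropy ν R)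
    (hQ : FiniteEntropy ν Q) (g : FreeGroup (Fin r)) :
    relShannon ν (join (join R (translate α g R)) Q) (translate α g Q) ≤ relShannon ν R Q := by
  rw [← relShannon_translate hα hR hQ g]
  exact relShannon_anti (hQ.translate hα g) ((hR.join (hR.translate hα g)).join hQ)
    (factorsThrough_join_left (factorsThrough_join_right .rfl _) _)

/-- Each of the r two-sided joins grows by at most 2H(Q | R); together with the coefficient 1 − 2r
this leaves one H(Q | R). -/
theorem bigF_join_le_add {R : X → ι} {Q : X → κ} (hR : FiniteEntropy ν R)
    (hQ : FiniteEntropy ν Q) : bigF α ν (join R Q) ≤ bigF α ν R + relShannon ν R Q := by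
  have h : ∀ i : Fin r, shannon ν (join (join R Q) (translate α (FreeGroup.of i) (join R Q))) ≤
      shannon ν (join R (translate α (FreeGroup.of i) R)) + 2 * relShannon ν R Q := fun i => by
    rw [shannon_join_translate_join hα hR hQ]
    linarith [relShannon_join_le hα hR hQ (FreeGroup.of i),
      relShannon_join_join_le hα hR hQ (FreeGroup.of i)]
  have hsum := Finset.sum_le_sum fun i (_ : i ∈ Finset.univ) => h i
  rw [Finset.sum_add_distrib] at hsum
  simp only [Finset.sum_const, Finset.card_univ, Fintype.card_fin, nsmul_eq_mul] at hsum
  have e : shannon ν (join R Q) = shannon ν R + relShannon ν R Q := by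
    rw [relShannon]; ring
  rw [bigF_eq, bigF_eq, e]
  linarith

/-- The two-sided joins only grow, so F can drop only through the term (1 − 2r)H(Q | R). -/
theorem bigF_le_join_add {R : X → ι} {Q : X → κ} (hR : FiniteEntropy ν R)
    (hQ : FiniteEntropy ν Q) :
    bigF α ν R ≤ bigF α ν (join R Q) + 2 * r * relShannon ν R Q := by
  have h : ∀ i : Fin r, shannon ν (join R (translate α (FreeGroup.of i) R)) ≤
      shannon ν (join (join R Q) (translate α (FreeGroup.of i) (join R Q))) := fun i => by
    rw [shannon_join_translate_join hα hR hQ]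
    linarith [relShannon_nonneg (hR.join (hR.translate hα (FreeGroup.of i))) hQ,
      relShannon_nonneg ((hR.join (hR.translate hα (FreeGroup.of i))).join hQ)
        (hQ.translate hα (FreeGroup.of i))]
  have hsum := Finset.sum_le_sum fun i (_ : i ∈ Finset.univ) => h i
  have e : shannon ν (join R Q) = shannon ν R + relShannon ν R Q := by
    rw [relShannon]; ring
  rw [bigF_eq, bigF_eq, e]
  linarith [relShannon_nonneg hR hQ]

/-- `F` does not increase when a partition is refined by a neighbouring translate of one of its
coarsenings. -/
theorem bigF_splitting {R : X → ι} {Q : X → κ} (hR : FiniteEntropy ν R)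
    (h : Q.FactorsThrough R) (j : Fin r) {s : FreeGroup (Fin r)}
    (hs : s = FreeGroup.of j ∨ s = (FreeGroup.of j)⁻¹) :
    bigF α ν (join R (translate α s Q)) ≤ bigF α ν R := by
  have hQ := (hR.of_factorsThrough h).translate hα s
  set S := translate α s Q with hS
  -- In direction j one of the two increments vanishes: s_j R already determines S if s = s_j, and R
  -- already determines s_j S if s = s_j⁻¹. This saves exactly the one H(S | R) that is left over in
  -- `bigF_join_le_add`.
  have hD : ∀ i : Fin r, shannon ν (join (join R S) (translate α (FreeGroup.of i) (join R S))) ≤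
      shannon ν (join R (translate α (FreeGroup.of i) R)) +
        (2 * relShannon ν R S - if i = j then relShannon ν R S else 0) := fun i => by
    rw [shannon_join_translate_join hα hR hQ]
    have h1 := relShannon_join_le hα hR hQ (FreeGroup.of i)
    have h2 := relShannon_join_join_le hα hR hQ (FreeGroup.of i)
    split_ifs with hij
    · subst hij
      rcases hs with rfl | rfl
      · rw [relShannon_eq_zero (hR.join (hR.translate hα _))
          (factorsThrough_join_right (factorsThrough_translate α h _) _)]
        linarith
      · have : (translate α (FreeGroup.of i) S).FactorsThrough
            (join (join R (translate α (FreeGroup.of i) R)) S) := by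
          rw [hS, translate_translate, mul_inv_cancel, translate_one]
          exact factorsThrough_join_left (factorsThrough_join_left h _) _
        rw [relShannon_eq_zero ((hR.join (hR.translate hα _)).join hQ) this]
        linarith
    · linarith
  have hsum := Finset.sum_le_sum fun i (_ : i ∈ Finset.univ) => hD i
  rw [Finset.sum_add_distrib, Finset.sum_sub_distrib, Finset.sum_ite_eq'] at hsum
  simp only [Finset.sum_const, Finset.card_univ, Fintype.card_fin, nsmul_eq_mul,
    Finset.mem_univ, if_true] at hsum
  have e : shannon ν (join R S) = shannon ν R + relShannon ν R S := by
    rw [relShannon]; ring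
  rw [bigF_eq, bigF_eq, e]
  linarith

omit hα in
theorem finite_ball (r n : ℕ) : (ball r n).Finite := by
  have : ball r n ⊆ FreeGroup.toWord ⁻¹' {L | L.length ≤ n} := fun g hg => hg
  exact ((List.finite_length_le _ n).preimage
    FreeGroup.toWord_injective.injOn).subset this

omit hα in
theorem ball_mono (r : ℕ) {m n : ℕ} (h : m ≤ n) : ball r m ⊆ ball r n :=
  fun _ hg => le_trans hg h

instance (r n : ℕ) : Finite (ball r n) :=
  (finite_ball r n).to_subtype

omit hα in
-- Split off the first letter of the reduced word; the remaining tail has length at most n.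
theorem exists_generator_mul_of_mem_ball_succ {n : ℕ} {g : FreeGroup (Fin r)}
    (hg : g ∈ ball r (n + 1)) (hg' : g ∉ ball r n) : ∃ (j : Fin r) (s w : FreeGroup (Fin r)),
      (s = FreeGroup.of j ∨ s = (FreeGroup.of j)⁻¹) ∧ w ∈ ball r n ∧ g = s * w := by
  rcases h : g.toWord with _ | ⟨⟨j, b⟩, L⟩
  · have : g = 1 := FreeGroup.toWord_eq_nil_iff.1 h
    exact absurd (by simp [ball, this]) hg'
  · refine ⟨j, FreeGroup.mk [(j, b)], FreeGroup.mk L, ?_, ?_, ?_⟩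
    · cases b
      · right
        simp [FreeGroup.of, FreeGroup.inv_mk, FreeGroup.invRev]
      · left
        rfl
    · have h1 : g.norm ≤ n + 1 := hg
      rw [FreeGroup.norm, h, List.length_cons] at h1
      exact FreeGroup.norm_mk_le.trans (by omega)
    · rw [FreeGroup.mul_mk, List.singleton_append, ← h, FreeGroup.mk_toWord]

/-- Joins over balls give an antitone sequence of values of `F`, relative to any partition. -/
theorem bigF_joinOver_ball_succ_le {P : X → ι} {Q : X → κ} (hP : FiniteEntropy ν P)
    (hQ : FiniteEntropy ν Q) (n : ℕ) :
    bigF α ν (join (joinOver α (ball r (n + 1)) P) Q) ≤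
      bigF α ν (join (joinOver α (ball r n) P) Q) := by
  -- The ball is enlarged one element at a time. Each new element is s w with w in the old ball, so
  -- `bigF_splitting` applies to the coarsening `translate α w P`.
  have key : ∀ T : Set (FreeGroup (Fin r)), T.Finite → T ⊆ ball r (n + 1) →
      bigF α ν (join (joinOver α (ball r n ∪ T) P) Q) ≤
        bigF α ν (join (joinOver α (ball r n) P) Q) := by
    intro T hT
    induction T, hT using Set.Finite.induction_on with
    | empty =>
      intro _
      rw [Set.union_empty]
    | @insert g T _ hT ih =>
      intro hsub
      rw [Set.insert_subset_iff] at hsub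
      refine le_trans ?_ (ih hsub.2)
      rw [Set.union_insert]
      by_cases hg : g ∈ ball r n
      · rw [Set.insert_eq_self.2 (Set.mem_union_left T hg)]
      obtain ⟨j, s, w, hs, hw, rfl⟩ := exists_generator_mul_of_mem_ball_succ hsub.1 hg
      have hfin := (finite_ball r n).union hT
      have := hfin.to_subtype
      have := (hfin.insert (s * w)).to_subtype
      have hR := (hP.joinOver hα hfin).join hQ
      have hspl := bigF_splitting hα (Q := translate α w P) hR
        (factorsThrough_join_left (factorsThrough_joinOver α (Or.inl hw) P) _) j hs
      rw [translate_translate] at hspl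
      refine (bigF_congr hα (hR.join (hP.translate hα _)) ?_ ?_).trans_le hspl
      · refine join_factorsThrough (joinOver_factorsThrough α ?_)
          (factorsThrough_join_left (factorsThrough_join_right .rfl _) _)
        rintro v (rfl | hv)
        · exact factorsThrough_join_right .rfl _
        · exact factorsThrough_join_left (factorsThrough_join_left
            (factorsThrough_joinOver α hv P) _) _
      · refine join_factorsThrough (join_factorsThrough (factorsThrough_join_left
          (joinOver_mono α (Set.subset_insert _ _) P) _) (factorsThrough_join_right .rfl _)) ?_
        exact factorsThrough_join_left (factorsThrough_joinOver α (Set.mem_insert _ _) P) _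
  have := key _ (finite_ball r (n + 1)) subset_rfl
  rwa [Set.union_eq_self_of_subset_left (ball_mono r n.le_succ)] at this

theorem antitone_bigF_join_joinOver {P : X → ι} {Q : X → κ} (hP : FiniteEntropy ν P)
    (hQ : FiniteEntropy ν Q) :
    Antitone fun n => bigF α ν (join (joinOver α (ball r n) P) Q) :=
  antitone_nat_of_succ_le fun n => bigF_joinOver_ball_succ_le hα hP hQ n

theorem antitone_bigF_joinOver {P : X → ι} (hP : FiniteEntropy ν P) :
    Antitone fun n => bigF α ν (joinOver α (ball r n) P) := by
  have hU : FiniteEntropy ν fun _ : X => () :=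
    ⟨fun _ => by simp, by rw [entropy_of_subsingleton]; simp⟩
  have h : ∀ n, bigF α ν (joinOver α (ball r n) P) =
      bigF α ν (join (joinOver α (ball r n) P) fun _ : X => ()) := fun n =>
    bigF_congr hα ((hP.joinOver hα (finite_ball r n)).join hU) (factorsThrough_join_left .rfl _)
      (join_factorsThrough .rfl fun _ _ _ => rfl)
  simp_rw [h]
  exact antitone_bigF_join_joinOver hα hP hU

/-- Admitting radius 0 is harmless, because the value at radius n + 1 is at most that at n. -/
theorem smallF_eq_iInf {P : X → ι} (hP : FiniteEntropy ν P) :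
    smallF α ν P = ⨅ n, (bigF α ν (joinOver α (ball r n) P) : EReal) := by
  refine le_antisymm (le_iInf fun n => ?_) (le_iInf₂ fun n _ => iInf_le _ n)
  exact (iInf₂_le (n + 1) n.succ_pos).trans
    (EReal.coe_le_coe_iff.2 (antitone_bigF_joinOver hα hP n.le_succ))

end BigF

/-! ### Small conditional entropy from approximation in measure. -/

section Approximation

open scoped symmDiff

/-- With x = u², η(x) ≤ 2u(1 − u) and (u(1 − u))² ≤ x(1 − x); then 2y ≤ ε + y²/ε. The factor x(1 −
x) is what a symmetric difference controls, linearly in the measure. -/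
theorem negMulLog_le_add_div {x ε : ℝ} (hx : 0 ≤ x) (hx1 : x ≤ 1) (hε : 0 < ε) :
    Real.negMulLog x ≤ ε + x * (1 - x) / ε := by
  rcases hx.eq_or_lt with rfl | hx
  · simpa using hε.le
  obtain ⟨u, hu, rfl⟩ : ∃ u : ℝ, 0 < u ∧ x = u ^ 2 :=
    ⟨√x, Real.sqrt_pos.2 hx, (Real.sq_sqrt hx.le).symm⟩
  have hu1 : u ≤ 1 := by nlinarith
  have h1 : Real.negMulLog (u ^ 2) ≤ 2 * (u * (1 - u)) := by
    have h := Real.log_le_sub_one_of_pos (inv_pos.2 hu)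
    rw [Real.log_inv] at h
    have h2 := mul_le_mul_of_nonneg_left h (by positivity : (0 : ℝ) ≤ 2 * u ^ 2)
    have h3 : 2 * u ^ 2 * (u⁻¹ - 1) = 2 * (u * (1 - u)) := by field_simp
    rw [Real.negMulLog, Real.log_pow]
    push_cast
    linarith
  refine h1.trans ?_
  have h4 : (u * (1 - u)) ^ 2 ≤ u ^ 2 * (1 - u ^ 2) := by
    have : 0 ≤ u ^ 2 * (1 - u) * (2 * u) := by
      have := sub_nonneg.2 hu1
      positivity
    nlinarith
  rw [← sub_nonneg]
  have h5 : ε + u ^ 2 * (1 - u ^ 2) / ε - 2 * (u * (1 - u)) =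
      ((ε - u * (1 - u)) ^ 2 + (u ^ 2 * (1 - u ^ 2) - (u * (1 - u)) ^ 2)) / ε := by
    field_simp
    ring
  rw [h5]
  exact div_nonneg (by nlinarith [sq_nonneg (ε - u * (1 - u))]) hε.le

variable {X ι κ : Type*} [MeasurableSpace X]

/-- On p the error q ∆ t is p \ q or p ∩ q, of measure ν(p)(1 − x) or ν(p)x with x = ν(p ∩ q)/ν(p).
Either one dominates ν(p)x(1 − x). -/
theorem condTerm_le (ν : Measure X) [IsFiniteMeasure ν] {p q t : Set X} (hq : MeasurableSet q)
    (ht : p ⊆ t ∨ Disjoint p t) {ε : ℝ} (hε : 0 < ε) :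
    condTerm ν p q ≤ ν.real p * ε + ν.real (p ∩ q ∆ t) / ε := by
  rcases eq_or_ne (ν.real p) 0 with h | h
  · simp only [condTerm, h, zero_mul, zero_add]
    positivity
  have hp : 0 < ν.real p := measureReal_nonneg.lt_of_ne' h
  have hle : ν.real (p ∩ q) ≤ ν.real p := measureReal_mono Set.inter_subset_left
  set x := ν.real (p ∩ q) / ν.real p with hx
  have hx0 : 0 ≤ x := by positivity
  have hx1 : x ≤ 1 := div_le_one_of_le₀ hle hp.le
  have hpx : ν.real p * x = ν.real (p ∩ q) := by rw [hx]; field_simp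
  have hb : ν.real p * (x * (1 - x)) ≤ ν.real (p ∩ q ∆ t) := by
    rcases ht with ht | ht
    · have h1 : p ∩ q ∆ t = p \ q := by
        ext y
        have := @ht y
        simp only [Set.mem_inter_iff, Set.mem_symmDiff, Set.mem_sdiff]
        tauto
      have h2 : ν.real (p ∩ q) + ν.real (p \ q) = ν.real p := measureReal_inter_add_sdiff hq
      rw [h1]
      have : ν.real p * (1 - x) = ν.real (p \ q) := by rw [mul_sub, hpx]; linarith
      rw [← this]
      nlinarith [mul_nonneg hp.le (sub_nonneg.2 hx1)]
    · have h1 : p ∩ q ∆ t = p ∩ q := by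
        ext y
        have := fun hy : y ∈ p => Set.disjoint_left.1 ht hy
        simp only [Set.mem_inter_iff, Set.mem_symmDiff]
        tauto
      rw [h1, ← hpx]
      nlinarith [mul_nonneg hp.le hx0]
  calc condTerm ν p q = ν.real p * Real.negMulLog x := rfl
    _ ≤ ν.real p * (ε + x * (1 - x) / ε) :=
        mul_le_mul_of_nonneg_left (negMulLog_le_add_div hx0 hx1 hε) hp.le
    _ = ν.real p * ε + ν.real p * (x * (1 - x)) / ε := by ring
    _ ≤ _ := by gcongr

theorem tsum_condTerm_le [Countable ι] (ν : Measure X) [IsProbabilityMeasure ν] {P : X → ι}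
    (hP : ∀ i, MeasurableSet (P ⁻¹' {i})) {q : Set X} (hq : MeasurableSet q) (T : Set ι) {ε : ℝ}
    (hε : 0 < ε) :
    ∑' i, ENNReal.ofReal (condTerm ν (P ⁻¹' {i}) q) ≤
      ENNReal.ofReal (ε + ν.real (q ∆ (P ⁻¹' T)) / ε) := by
  have hT := measurableSet_preimage_of_cells hP T
  have hle : ∀ i, condTerm ν (P ⁻¹' {i}) q ≤ ν.real (Set.univ ∩ P ⁻¹' {i}) * ε +
      ν.real (q ∆ (P ⁻¹' T) ∩ P ⁻¹' {i}) / ε := fun i => by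
    have := condTerm_le ν (p := P ⁻¹' {i}) (t := P ⁻¹' T) hq ?_ hε
    · rwa [Set.univ_inter, Set.inter_comm (q ∆ _)]
    · by_cases hi : i ∈ T
      · exact Or.inl (Set.preimage_mono (by simpa using hi))
      · exact Or.inr (Disjoint.preimage _ (by simpa using hi))
  have hs := ((hasSum_measureReal_inter_cell ν hP MeasurableSet.univ).mul_right ε).add
    ((hasSum_measureReal_inter_cell ν hP (hq.symmDiff hT)).div_const ε)
  refine (ENNReal.tsum_le_tsum fun i => ENNReal.ofReal_le_ofReal (hle i)).trans_eq ?_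
  rw [← ENNReal.ofReal_tsum_of_nonneg (fun k => (condTerm_nonneg _ _ _).trans (hle k)) hs.summable,
    hs.tsum_eq]
  simp

end Approximation

/-! ### Generating partitions: approximation by finite windows and vanishing conditional entropy. -/

section Generating

open scoped symmDiff

variable {Γ X ι κ : Type*} [Group Γ]

theorem translate_preimage_singleton (α : Γ →* Equiv.Perm X) (g : Γ) (P : X → ι) (i : ι) :
    translate α g P ⁻¹' {i} = α g '' (P ⁻¹' {i}) := by
  rw [(α g).image_eq_preimage_symm]
  rfl

/-- The σ-algebra generated by the cells of all translates is itself invariant, so `m` need only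
contain those cells and need not be invariant. -/
theorem invariantSigma_le {α : Γ →* Equiv.Perm X} {P : X → ι} {m : MeasurableSpace X}
    (h : ∀ g i, MeasurableSet[m] (translate α g P ⁻¹' {i})) : invariantSigma α P ≤ m := by
  let C : Set (Set X) := {s | ∃ g i, s = translate α g P ⁻¹' {i}}
  have h1 : invariantSigma α P ≤ MeasurableSpace.generateFrom C := by
    refine sInf_le ⟨fun g s hs => ?_, fun i => ?_⟩
    · have : @Measurable _ _ (.generateFrom C) (.generateFrom C) (α g).symm := by
        refine @measurable_generateFrom _ _ (.generateFrom C) _ _ ?_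
        rintro _ ⟨k, i, rfl⟩
        refine MeasurableSpace.measurableSet_generateFrom ⟨g * k, i, ?_⟩
        rw [← translate_translate]
        rfl
      rw [(α g).image_eq_preimage_symm]
      exact this hs
    · exact MeasurableSpace.measurableSet_generateFrom ⟨1, i, by rw [translate_one]⟩
  refine h1.trans (MeasurableSpace.generateFrom_le ?_)
  rintro _ ⟨g, i, rfl⟩
  exact h g i

theorem measurableSet_invariantSigma_translate (α : Γ →* Equiv.Perm X) (P : X → ι) (g : Γ)
    (i : ι) : MeasurableSet[invariantSigma α P] (translate α g P ⁻¹' {i}) := by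
  rw [translate_preimage_singleton]
  refine MeasurableSpace.measurableSet_sInf.2 fun m hm => hm.1 g _ (hm.2 i)

theorem IsGenerating.comp_injective [Countable ι] [MeasurableSpace X] {ν : Measure X}
    {α : Γ →* Equiv.Perm X} {P : X → ι} (hP : IsGenerating α ν P) {f : ι → κ} (hf : Injective f) :
    IsGenerating α ν (f ∘ P) := by
  refine ⟨fun i => measurableSet_preimage_of_cells hP.measurableSet_cell (f ⁻¹' {i}),
    fun s hs => ?_⟩
  obtain ⟨t, ht, hts⟩ := hP.exists_ae_eq s hs
  refine ⟨t, ?_, hts⟩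
  have hle : invariantSigma α P ≤ invariantSigma α (f ∘ P) := by
    refine invariantSigma_le fun g i => ?_
    convert measurableSet_invariantSigma_translate α (f ∘ P) g (f i) using 1
    ext x
    simp [translate, hf.eq_iff]
  exact hle t ht

theorem exists_preimage_eq_of_factorsThrough {P : X → ι} {Q : X → κ} (h : P.FactorsThrough Q)
    (T : Set ι) : ∃ T' : Set κ, P ⁻¹' T = Q ⁻¹' T' := by
  refine ⟨Q '' (P ⁻¹' T), ?_⟩
  ext x
  refine ⟨fun hx => ⟨x, hx, rfl⟩, ?_⟩
  rintro ⟨y, hy, hyx⟩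
  rw [Set.mem_preimage, ← h hyx]
  exact hy

variable {r : ℕ} [MeasurableSpace X] {ν : Measure X} [IsProbabilityMeasure ν]
  {α : FreeGroup (Fin r) →* Equiv.Perm X} [Countable ι]

omit [IsProbabilityMeasure ν] in
theorem measurableSet_joinOver_preimage (hα : ∀ g, MeasurePreserving (α g) ν ν) {P : X → ι}
    (hP : ∀ i, MeasurableSet (P ⁻¹' {i})) (n : ℕ) (T : Set (ball r n → ι)) :
    MeasurableSet (joinOver α (ball r n) P ⁻¹' T) := by
  refine measurableSet_preimage_of_cells (fun i => ?_) T
  have : joinOver α (ball r n) P ⁻¹' {i} = ⋂ w : ball r n, translate α (w : _) P ⁻¹' {i w} := by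
    ext x
    simp [funext_iff, joinOver]
  rw [this]
  refine MeasurableSet.iInter fun w => ?_
  rw [translate_eq_comp]
  exact (hα _).measurable (hP _)

/-- Sets determined by finite balls form an algebra, because balls are nested. It generates a
σ-algebra containing `invariantSigma α P`, and a generating algebra is dense in measure. -/
theorem IsGenerating.exists_symmDiff_lt (hα : ∀ g, MeasurePreserving (α g) ν ν) {P : X → ι}
    (hP : IsGenerating α ν P) {s : Set X} (hs : MeasurableSet s) {ε : ℝ} (hε : 0 < ε) :
    ∃ (n : ℕ) (T : Set (ball r n → ι)), ν.real (s ∆ (joinOver α (ball r n) P ⁻¹' T)) < ε := by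
  let 𝒜 : Set (Set X) := {t | ∃ (n : ℕ) (T : Set (ball r n → ι)), t = joinOver α (ball r n) P ⁻¹' T}
  have halg : IsSetAlgebra 𝒜 := by
    refine ⟨⟨0, ∅, rfl⟩, ?_, ?_⟩
    · rintro _ ⟨n, T, rfl⟩
      exact ⟨n, Tᶜ, rfl⟩
    · rintro _ _ ⟨n, T, rfl⟩ ⟨m, U, rfl⟩
      obtain ⟨T', hT'⟩ := exists_preimage_eq_of_factorsThrough
        (joinOver_mono α (ball_mono r (le_max_left n m)) P) T
      obtain ⟨U', hU'⟩ := exists_preimage_eq_of_factorsThrough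
        (joinOver_mono α (ball_mono r (le_max_right n m)) P) U
      exact ⟨max n m, T' ∪ U', by rw [hT', hU', Set.preimage_union]⟩
  have hm : MeasurableSpace.generateFrom 𝒜 ≤ ‹MeasurableSpace X› := by
    refine MeasurableSpace.generateFrom_le ?_
    rintro _ ⟨n, T, rfl⟩
    exact measurableSet_joinOver_preimage hα hP.measurableSet_cell n T
  have hle : invariantSigma α P ≤ MeasurableSpace.generateFrom 𝒜 := by
    refine invariantSigma_le fun g i => MeasurableSpace.measurableSet_generateFrom ?_
    exact ⟨g.norm, {a | a ⟨g, le_refl g.norm⟩ = i}, rfl⟩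
  obtain ⟨t', ht', htt'⟩ := hP.exists_ae_eq s hs
  -- The measure is trimmed because the algebra generates the ambient σ-algebra only up to null
  -- sets.
  have hdense := @Measure.MeasureDense.of_generateFrom_isSetAlgebra_finite X
    (.generateFrom 𝒜) (ν.trim hm) 𝒜 _ halg rfl
  obtain ⟨_, ⟨n, T, rfl⟩, hT⟩ := @Measure.MeasureDense.approx _ (.generateFrom 𝒜) _ _ hdense t' (hle t' ht')
    (@measure_ne_top _ (.generateFrom 𝒜) _ _ _) ε hε
  refine ⟨n, T, ?_⟩
  have hcongr : ν (t' ∆ (joinOver α (ball r n) P ⁻¹' T)) =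
      ν (s ∆ (joinOver α (ball r n) P ⁻¹' T)) :=
    measure_congr (htt'.symmDiff (ae_eq_refl _))
  rw [trim_measurableSet_eq hm (@MeasurableSet.symmDiff _ (.generateFrom 𝒜) _ _ (hle t' ht')
    (MeasurableSpace.measurableSet_generateFrom ⟨n, T, rfl⟩)), hcongr] at hT
  rw [measureReal_def, ← ENNReal.lt_ofReal_iff_toReal_lt (measure_ne_top _ _)]
  exact hT

/-- The contribution of each single cell of Q tends to 0 by approximation and is bounded by η of its
measure. These bounds sum to H(Q) < ∞, so dominated convergence applies. -/
theorem tendsto_relShannon_joinOver (hα : ∀ g, MeasurePreserving (α g) ν ν) [Countable κ]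
    {P : X → ι} {Q : X → κ} (hg : IsGenerating α ν P) (hP : FiniteEntropy ν P)
    (hQ : FiniteEntropy ν Q) :
    Tendsto (fun n => relShannon ν (joinOver α (ball r n) P) Q) atTop (𝓝 0) := by
  have hR := fun n => hP.joinOver hα (finite_ball r n)
  let g : ℕ → κ → ℝ≥0∞ := fun n j =>
    ∑' i, ENNReal.ofReal (condTerm ν (joinOver α (ball r n) P ⁻¹' {i}) (Q ⁻¹' {j}))
  have hle : ∀ n j, g n j ≤ ENNReal.ofReal (Real.negMulLog (ν.real (Q ⁻¹' {j}))) := fun n j =>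
    tsum_condTerm_le_negMulLog ν (hR n).cells (hQ.cells j)
  have hrel : ∀ n, relShannon ν (joinOver α (ball r n) P) Q = ∑' j, (g n j).toReal := fun n => by
    rw [relShannon_eq (hR n) hQ, condEntropy, ENNReal.tsum_comm, ENNReal.tsum_toReal_eq]
    exact fun j => ne_top_of_le_ne_top ENNReal.ofReal_ne_top (hle n j)
  have hlim : ∀ j, Tendsto (fun n => (g n j).toReal) atTop (𝓝 0) := fun j => by
    refine Metric.tendsto_atTop.2 fun ε hε => ?_
    -- With δ = ε/3 and an error below δ², the bound δ + δ²/δ is 2ε/3 < ε.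
    obtain ⟨N, T, hT⟩ := hg.exists_symmDiff_lt hα (hQ.cells j) (ε := (ε / 3) ^ 2) (by positivity)
    refine ⟨N, fun n hn => ?_⟩
    obtain ⟨T', hT'⟩ := exists_preimage_eq_of_factorsThrough
      (joinOver_mono α (ball_mono r hn) P) T
    rw [hT'] at hT
    have hb := tsum_condTerm_le ν (hR n).cells (hQ.cells j) T' (ε := ε / 3) (by positivity)
    have hb' := ENNReal.toReal_mono ENNReal.ofReal_ne_top hb
    rw [ENNReal.toReal_ofReal (by positivity)] at hb'
    have hd : ν.real ((Q ⁻¹' {j}) ∆ (joinOver α (ball r n) P ⁻¹' T')) / (ε / 3) ≤ ε / 3 := by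
      rw [div_le_iff₀ (by positivity)]
      nlinarith
    rw [Real.dist_0_eq_abs, abs_of_nonneg ENNReal.toReal_nonneg]
    exact hb'.trans_lt (by linarith)
  simp_rw [hrel]
  have := tendsto_tsum_of_dominated_convergence (f := fun n j => (g n j).toReal) (g := fun _ => 0)
    (bound := fun j => (ENNReal.ofReal (Real.negMulLog (ν.real (Q ⁻¹' {j})))).toReal)
    (𝓕 := atTop) (ENNReal.summable_toReal hQ.ne_top) hlim (Eventually.of_forall fun n j => by
      rw [Real.norm_of_nonneg ENNReal.toReal_nonneg]
      exact ENNReal.toReal_mono ENNReal.ofReal_ne_top (hle n j))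
  simpa using this

end Generating

/-! ### Independence of f from the choice of generator. -/

section Independence

/-- Both infima are limits. Since c is finite, addition in `EReal` is continuous at the limit point
even if the infimum of h is −∞. -/
theorem iInf_coe_eq_add_of_tendsto_sub {g h : ℕ → ℝ} (hg : Antitone g) (hh : Antitone h) {c : ℝ}
    (hc : Tendsto (fun n => g n - h n) atTop (𝓝 c)) :
    ⨅ n, (g n : EReal) = (⨅ n, (h n : EReal)) + c := by
  have hg' := tendsto_atTop_iInf (f := fun n => (g n : EReal))
    fun _ _ hmn => EReal.coe_le_coe_iff.2 (hg hmn)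
  have hh' := tendsto_atTop_iInf (f := fun n => (h n : EReal))
    fun _ _ hmn => EReal.coe_le_coe_iff.2 (hh hmn)
  have hc' : Tendsto (fun n => ((g n - h n : ℝ) : EReal)) atTop (𝓝 c) :=
    (continuous_coe_real_ereal.tendsto c).comp hc
  have hadd := (EReal.continuousAt_add (p := (⨅ n, (h n : EReal), (c : EReal)))
    (Or.inr (EReal.coe_ne_bot c)) (Or.inr (EReal.coe_ne_top c))).tendsto.comp (hh'.prodMk_nhds hc')
  refine tendsto_nhds_unique hg' (hadd.congr fun n => ?_)
  simp only [comp_apply]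
  rw [← EReal.coe_add]
  congr 1
  ring

variable {r : ℕ} {X ι κ : Type*} [MeasurableSpace X] {ν : Measure X} [IsProbabilityMeasure ν]
  {α : FreeGroup (Fin r) →* Equiv.Perm X} (hα : ∀ g, MeasurePreserving (α g) ν ν)
  [Countable ι] [Countable κ]

include hα

/-- Joining with Q changes F by at most a multiple of H(Q | P^{B(n)}), which tends to 0. -/
theorem iInf_bigF_join_eq_smallF {P : X → ι} {Q : X → κ} (hg : IsGenerating α ν P)
    (hP : FiniteEntropy ν P) (hQ : FiniteEntropy ν Q) :
    ⨅ n, (bigF α ν (join (joinOver α (ball r n) P) Q) : EReal) = smallF α ν P := by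
  have hR := fun n => hP.joinOver hα (finite_ball r n)
  have hlim := tendsto_relShannon_joinOver hα hg hP hQ
  have hc : Tendsto (fun n => bigF α ν (join (joinOver α (ball r n) P) Q) -
      bigF α ν (joinOver α (ball r n) P)) atTop (𝓝 0) := by
    refine tendsto_of_tendsto_of_tendsto_of_le_of_le
      (g := fun n => -(2 * r * relShannon ν (joinOver α (ball r n) P) Q)) ?_ hlim ?_ ?_
    · simpa using (hlim.const_mul (2 * (r : ℝ))).neg
    · intro n
      have := bigF_le_join_add hα (hR n) hQ
      simp only
      linarith
    · intro n
      have := bigF_join_le_add hα (hR n) hQ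
      simp only
      linarith
  rw [smallF_eq_iInf hα hP, iInf_coe_eq_add_of_tendsto_sub
    (antitone_bigF_join_joinOver hα hP hQ) (antitone_bigF_joinOver hα hP) hc]
  simp

/-- The value `f_ν(α, P)` does not depend on the finite-entropy generating partition `P`. -/
theorem smallF_eq_smallF {P : X → ι} {Q : X → κ} (hgP : IsGenerating α ν P)
    (hP : FiniteEntropy ν P) (hgQ : IsGenerating α ν Q) (hQ : FiniteEntropy ν Q) :
    smallF α ν P = smallF α ν Q := by
  have hRP := fun n => hP.joinOver hα (finite_ball r n)
  have hRQ := fun n => hQ.joinOver hα (finite_ball r n)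
  have hcomm : ∀ k n, bigF α ν (join (joinOver α (ball r k) P) (joinOver α (ball r n) Q)) =
      bigF α ν (join (joinOver α (ball r n) Q) (joinOver α (ball r k) P)) := fun k n =>
    bigF_congr hα ((hRQ n).join (hRP k))
      (join_factorsThrough (factorsThrough_join_right .rfl _) (factorsThrough_join_left .rfl _))
      (join_factorsThrough (factorsThrough_join_right .rfl _) (factorsThrough_join_left .rfl _))
  calc smallF α ν P = ⨅ n, ⨅ k, (bigF α ν (join (joinOver α (ball r k) P)
        (joinOver α (ball r n) Q)) : EReal) := by
        simp_rw [iInf_bigF_join_eq_smallF hα hgP hP (hRQ _), iInf_const]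
    _ = ⨅ k, ⨅ n, (bigF α ν (join (joinOver α (ball r n) Q)
        (joinOver α (ball r k) P)) : EReal) := by
        rw [iInf_comm]
        simp_rw [hcomm]
    _ = smallF α ν Q := by
        simp_rw [iInf_bigF_join_eq_smallF hα hgQ hQ (hRP _), iInf_const]

theorem hasFInvariant_smallF {P : X → ι} (hg : IsGenerating α ν P) (hP : entropy ν P ≠ ∞) :
    HasFInvariant α ν (smallF α ν P) := by
  obtain ⟨f, hf⟩ := exists_injective_nat ι
  refine ⟨⟨f ∘ P, hg.comp_injective hf, ?_⟩, fun Q hQ => ?_⟩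
  · rwa [entropy_comp_injective ν P hf]
  · exact smallF_eq_smallF hα hQ.1 ⟨hQ.1.measurableSet_cell, hQ.2⟩ hg ⟨hg.measurableSet_cell, hP⟩

end Independence

/-- With `factorsThrough_join_translate_joinOver`, this turns each two-sided join in F into a join
over the single window W ∪ gW, to which the skew-product estimate applies. -/
theorem join_translate_joinOver_factorsThrough {Γ X ι : Type*} [Group Γ] (α : Γ →* Equiv.Perm X)
    (W : Set Γ) (g : Γ) (P : X → ι) :
    (join (joinOver α W P) (translate α g (joinOver α W P))).FactorsThrough
      (joinOver α (W ∪ (g * ·) '' W) P) := by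
  refine join_factorsThrough (joinOver_mono α Set.subset_union_left P) fun x y hxy => ?_
  funext w
  have := congrFun hxy ⟨g * w, Or.inr ⟨w, w.2, rfl⟩⟩
  simp only [joinOver] at this
  rwa [← translate_translate] at this

theorem factorsThrough_join_translate_joinOver {Γ X ι : Type*} [Group Γ] (α : Γ →* Equiv.Perm X)
    (W : Set Γ) (g : Γ) (P : X → ι) :
    (joinOver α (W ∪ (g * ·) '' W) P).FactorsThrough
      (join (joinOver α W P) (translate α g (joinOver α W P))) := by
  refine joinOver_factorsThrough α ?_
  rintro _ (hw | ⟨w, hw, rfl⟩)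
  · exact factorsThrough_join_left (factorsThrough_joinOver α hw P) _
  · simp only
    rw [← translate_translate]
    exact factorsThrough_join_right
      (factorsThrough_translate α (factorsThrough_joinOver α hw P) g) _

/-! ### Entropy and generators of the skew product. -/

section Skew

variable {Γ X G ι : Type*} [Group Γ] [Group G] [MeasurableSpace X] [MeasurableSpace G]
  {α : Γ →* Equiv.Perm X} {β : Γ →* MulAut G} {σ : Γ → X → G} (hσ : IsCocycle α β σ)
  (N : Subgroup G) [N.Normal]

theorem translate_skewProduct_fst (g : Γ) (P : X → ι) :
    translate (skewProduct α β σ hσ) g (P ∘ Prod.fst) = translate α g P ∘ Prod.fst := by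
  simp only [translate_eq_comp]
  rfl

theorem joinOver_skewProduct_fst (W : Set Γ) (P : X → ι) :
    joinOver (skewProduct α β σ hσ) W (P ∘ Prod.fst) = joinOver α W P ∘ Prod.fst := by
  funext x w
  exact congrFun (translate_skewProduct_fst hσ w P) x

/-- The cosets modulo `N` of the values of the cocycle at the inverses of the elements of `W`. -/
def cocycleCosets (σ : Γ → X → G) (N : Subgroup G) (W : Set Γ) (x : X) : W → G ⧸ N :=
  fun w => (σ (w : Γ)⁻¹ x : G ⧸ N)

/-- The inverse g⁻¹ sends y to β_{g⁻¹}(y)σ(g⁻¹, x), and by normality cosets multiply. This separates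
the fibre dependence from the base dependence. -/
theorem translate_skewProduct_snd (g : Γ) (p : X × G) :
    translate (skewProduct α β σ hσ) g ((fun y : G => (y : G ⧸ N)) ∘ Prod.snd) p =
      translate (autAction β) g (fun y : G => (y : G ⧸ N)) p.2 * (σ g⁻¹ p.1 : G ⧸ N) := by
  simp only [translate_eq_comp]
  rfl

theorem joinOver_skewProduct_snd (W : Set Γ) (p : X × G) :
    joinOver (skewProduct α β σ hσ) W ((fun y : G => (y : G ⧸ N)) ∘ Prod.snd) p =
      joinOver (autAction β) W (fun y : G => (y : G ⧸ N)) p.2 * cocycleCosets σ N W p.1 := by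
  funext w
  exact translate_skewProduct_snd hσ N w p

variable [N.FiniteIndex] {ν : Measure X} [IsProbabilityMeasure ν] {μ : Measure G}
  [IsProbabilityMeasure μ] (hN : ∀ q : G ⧸ N, MeasurableSet ((fun y : G => (y : G ⧸ N)) ⁻¹' {q}))

include hσ hN

omit [N.Normal] [IsProbabilityMeasure ν] in
theorem finiteEntropy_cocycleCosets {W : Set Γ} (hW : W.Finite) :
    FiniteEntropy ν (cocycleCosets σ N W) := by
  have := hW.to_subtype
  refine ⟨fun c => ?_, entropy_ne_top_of_finite ν _⟩
  have : cocycleCosets σ N W ⁻¹' {c} =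
      ⋂ w : W, σ (w : Γ)⁻¹ ⁻¹' ((fun y : G => (y : G ⧸ N)) ⁻¹' {c w}) := by
    ext x
    simp [funext_iff, cocycleCosets]
  rw [this]
  exact MeasurableSet.iInter fun w => hσ.measurable _ (hN _)

omit hσ [N.Normal] [IsProbabilityMeasure μ] in
theorem finiteEntropy_coset : FiniteEntropy μ fun y : G => (y : G ⧸ N) :=
  ⟨hN, entropy_ne_top_of_finite μ _⟩

variable (hγ : ∀ g, MeasurePreserving (skewProduct α β σ hσ g) (ν.prod μ) (ν.prod μ))
  (hβ : ∀ g, MeasurePreserving (autAction β g) μ μ) [Countable ι]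

include hβ hγ

/-- Let T be the twisted and T' the untwisted fibre partition. Given c, T and T' determine each
other, so independence gives H(A ∨ c ∨ T) = H(A ∨ c) + H(T'). Dropping c from the left side lowers
it by H(c | A ∨ T), which lies between 0 and H(c | A). -/
theorem shannon_skewProduct_bounds {A : X → ι} (hA : FiniteEntropy ν A) {W : Set Γ}
    (hW : W.Finite) :
    shannon ν A + shannon μ (joinOver (autAction β) W fun y : G => (y : G ⧸ N)) ≤
        shannon (ν.prod μ) (join (A ∘ Prod.fst) (joinOver (skewProduct α β σ hσ) W
          ((fun y : G => (y : G ⧸ N)) ∘ Prod.snd))) ∧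
      shannon (ν.prod μ) (join (A ∘ Prod.fst) (joinOver (skewProduct α β σ hσ) W
          ((fun y : G => (y : G ⧸ N)) ∘ Prod.snd))) ≤
        shannon ν A + shannon μ (joinOver (autAction β) W fun y : G => (y : G ⧸ N)) +
          relShannon ν A (cocycleCosets σ N W) := by
  have := hW.to_subtype
  have hfst : MeasurePreserving Prod.fst (ν.prod μ) ν := measurePreserving_fst
  have hsnd : MeasurePreserving Prod.snd (ν.prod μ) μ := measurePreserving_snd
  have hq : FiniteEntropy μ fun y : G => (y : G ⧸ N) := finiteEntropy_coset N hN
  have hT' := hq.joinOver hβ hW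
  have hT := (hq.comp_measurePreserving hsnd).joinOver hγ hW
  have hc : FiniteEntropy ν (cocycleCosets σ N W) := finiteEntropy_cocycleCosets hσ N hN hW
  have hfac := joinOver_skewProduct_snd hσ N W
  set T' := joinOver (autAction β) W fun y : G => (y : G ⧸ N)
  set T := joinOver (skewProduct α β σ hσ) W ((fun y : G => (y : G ⧸ N)) ∘ Prod.snd)
  set c := cocycleCosets σ N W
  have hA' := hA.comp_measurePreserving hfst
  have hc' := hc.comp_measurePreserving hfst
  have hD := hA.join hc
  have h1 : shannon (ν.prod μ) (join (join A c ∘ Prod.fst) T) =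
      shannon ν A + relShannon ν A c + shannon μ T' := by
    have e1 : shannon (ν.prod μ) (join (join A c ∘ Prod.fst) T) =
        shannon (ν.prod μ) (join (join A c ∘ Prod.fst) (T' ∘ Prod.snd)) := by
      refine shannon_congr ((hD.comp_measurePreserving hfst).join
        (hT'.comp_measurePreserving hsnd)) (fun x y hxy => ?_) fun x y hxy => ?_
      · simp only [join, comp_apply, Prod.mk.injEq] at hxy ⊢
        rw [hfac, hfac, hxy.1.2, hxy.2]
        exact ⟨⟨hxy.1.1, rfl⟩, rfl⟩
      · simp only [join, comp_apply, Prod.mk.injEq] at hxy ⊢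
        have h := hxy.2
        rw [hfac, hfac, hxy.1.2] at h
        exact ⟨hxy.1, mul_right_cancel h⟩
    rw [e1, shannon, entropy_prod ν μ hD.cells hT'.cells,
      ENNReal.toReal_add hD.ne_top hT'.ne_top, relShannon, shannon, shannon, shannon]
    ring
  constructor
  · have h2 : shannon (ν.prod μ) (join (join (A ∘ Prod.fst) T) (c ∘ Prod.fst)) =
        shannon (ν.prod μ) (join (join A c ∘ Prod.fst) T) := by
      refine shannon_congr ((hD.comp_measurePreserving hfst).join hT)
        (fun x y hxy => ?_) fun x y hxy => ?_ <;>
      · simp only [join, comp_apply, Prod.mk.injEq] at hxy ⊢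
        tauto
    have h3 : relShannon (ν.prod μ) (join (A ∘ Prod.fst) T) (c ∘ Prod.fst) ≤
        relShannon (ν.prod μ) (A ∘ Prod.fst) (c ∘ Prod.fst) :=
      relShannon_anti hc' (hA'.join hT) (factorsThrough_join_left .rfl _)
    have h4 : relShannon (ν.prod μ) (A ∘ Prod.fst) (c ∘ Prod.fst) = relShannon ν A c := by
      rw [relShannon, relShannon, shannon_comp_measurePreserving hA hfst,
        ← shannon_comp_measurePreserving hD hfst]
      rfl
    rw [h4, relShannon, h2, h1] at h3
    linarith
  · have h2 : shannon (ν.prod μ) (join (A ∘ Prod.fst) T) ≤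
        shannon (ν.prod μ) (join (join A c ∘ Prod.fst) T) := by
      refine shannon_mono ((hD.comp_measurePreserving hfst).join hT) fun x y hxy => ?_
      simp only [join, comp_apply, Prod.mk.injEq] at hxy ⊢
      tauto
    linarith

omit hβ hγ hN [IsProbabilityMeasure ν] [IsProbabilityMeasure μ] in
/-- The lifts of generating partitions of the base and of the fibre generate the skew product. -/
theorem isGenerating_skewProduct {P : X → ι} (hP : IsGenerating α ν P)
    (hq : IsGenerating (autAction β) μ fun y : G => (y : G ⧸ N)) :
    IsGenerating (skewProduct α β σ hσ) (ν.prod μ)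
      (join (P ∘ Prod.fst) ((fun y : G => (y : G ⧸ N)) ∘ Prod.snd)) := by
  refine ⟨measurableSet_join_cell (fun i => measurable_fst (hP.measurableSet_cell i))
    fun i => measurable_snd (hq.measurableSet_cell i), ?_⟩
  set γ := skewProduct α β σ hσ
  set R := join (P ∘ Prod.fst) ((fun y : G => (y : G ⧸ N)) ∘ (Prod.snd : X × G → G)) with hR
  have hcell : ∀ (g : Γ) (S : Set (ι × (G ⧸ N))),
      MeasurableSet[invariantSigma γ R] (translate γ g R ⁻¹' S) := fun g S =>
    @measurableSet_preimage_of_cells _ _ (invariantSigma γ R) _ _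
      (measurableSet_invariantSigma_translate γ R g) S
  -- Base sets are recovered only modulo null sets, so the argument runs in the σ-algebra of sets
  -- almost everywhere equal to invariant ones.
  let C := eventuallyMeasurableSpace (invariantSigma γ R) (ae (ν.prod μ))
  have hleC : invariantSigma γ R ≤ C := le_eventuallyMeasurableSpace
  have hfst : ∀ A : Set X, MeasurableSet A → MeasurableSet[C] (Prod.fst ⁻¹' A) := by
    intro A hA
    obtain ⟨t, ht, htA⟩ := hP.exists_ae_eq A hA
    have hle : invariantSigma α P ≤ MeasurableSpace.map Prod.fst (invariantSigma γ R) := by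
      refine invariantSigma_le fun g i => ?_
      have h := hcell g (Prod.fst ⁻¹' {i})
      have e : translate γ g R ⁻¹' (Prod.fst ⁻¹' {i}) =
          Prod.fst ⁻¹' (translate α g P ⁻¹' {i}) := by
        rw [← Set.preimage_comp, ← Set.preimage_comp, ← translate_skewProduct_fst hσ]
        rfl
      rw [e] at h
      exact h
    exact ⟨Prod.fst ⁻¹' t, hle t ht,
      (Measure.quasiMeasurePreserving_fst.preimage_ae_eq htA).symm⟩
  have hsnd : ∀ B : Set G, MeasurableSet B → MeasurableSet[C] (Prod.snd ⁻¹' B) := by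
    intro B hB
    obtain ⟨t, ht, htB⟩ := hq.exists_ae_eq B hB
    have hle : invariantSigma (autAction β) (fun y : G => (y : G ⧸ N)) ≤
        MeasurableSpace.map Prod.snd C := by
      refine invariantSigma_le fun g q => ?_
      -- The untwisted coset is q exactly when, for the value c of the cocycle coset, the twisted
      -- one is q * c. The condition on c is a base set, already known to lie in `C`.
      have e : (Prod.snd : X × G → G) ⁻¹' (translate (autAction β) g
          (fun y : G => (y : G ⧸ N)) ⁻¹' {q}) =
          ⋃ c : G ⧸ N, translate γ g R ⁻¹' (Prod.snd ⁻¹' {q * c}) ∩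
            Prod.fst ⁻¹' (σ g⁻¹ ⁻¹' ((fun y : G => (y : G ⧸ N)) ⁻¹' {c})) := by
        ext p
        have h : (translate γ g R p).2 = _ := translate_skewProduct_snd hσ N g p
        simp only [Set.mem_iUnion, Set.mem_inter_iff, Set.mem_preimage, Set.mem_singleton_iff, h]
        constructor
        · intro hp
          exact ⟨_, by rw [hp], rfl⟩
        · rintro ⟨c, h1, h2⟩
          rw [h2] at h1
          exact mul_right_cancel h1
      change MeasurableSet[C] _
      rw [e]
      exact MeasurableSet.iUnion fun c => MeasurableSet.inter (hleC _ (hcell g _))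
        (hfst _ (hσ.measurable _ (hq.measurableSet_cell c)))
    obtain ⟨u, hu, hut⟩ := hle t ht
    exact ⟨u, hu, (Measure.quasiMeasurePreserving_snd.preimage_ae_eq htB).symm.trans hut⟩
  have hall : (Prod.instMeasurableSpace : MeasurableSpace (X × G)) ≤ C := by
    refine sup_le (α := MeasurableSpace (X × G)) ?_ ?_
    · rintro _ ⟨A, hA, rfl⟩
      exact hfst A hA
    · rintro _ ⟨B, hB, rfl⟩
      exact hsnd B hB
  intro s hs
  obtain ⟨t, ht, hst⟩ := hall s hs
  exact ⟨t, ht, hst.symm⟩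

end Skew

/-! ### The addition formula for fixed generators. -/

section SkewF

variable {r : ℕ} {X G ι : Type*} [Group G] [MeasurableSpace X] [MeasurableSpace G]
  {α : FreeGroup (Fin r) →* Equiv.Perm X} {β : FreeGroup (Fin r) →* MulAut G}
  {σ : FreeGroup (Fin r) → X → G} (hσ : IsCocycle α β σ)
  (N : Subgroup G) [N.Normal] [N.FiniteIndex] {ν : Measure X} [IsProbabilityMeasure ν]
  {μ : Measure G} [IsProbabilityMeasure μ]
  (hN : ∀ q : G ⧸ N, MeasurableSet ((fun y : G => (y : G ⧸ N)) ⁻¹' {q}))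
  (hα : ∀ g, MeasurePreserving (α g) ν ν)
  (hβ : ∀ g, MeasurePreserving (autAction β g) μ μ)
  (hγ : ∀ g, MeasurePreserving (skewProduct α β σ hσ g) (ν.prod μ) (ν.prod μ)) [Countable ι]

include hσ hN hα hβ hγ

/-- F is a finite linear combination of entropies, and in each the base and fibre contributions
separate up to an error that vanishes as k → ∞. -/
theorem tendsto_bigF_skewProduct_sub {P : X → ι} (hg : IsGenerating α ν P)
    (hP : FiniteEntropy ν P) (n : ℕ) :
    Tendsto (fun k => bigF (skewProduct α β σ hσ) (ν.prod μ)
        (join (joinOver (skewProduct α β σ hσ) (ball r k) (P ∘ Prod.fst))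
          (joinOver (skewProduct α β σ hσ) (ball r n) ((fun y : G => (y : G ⧸ N)) ∘ Prod.snd))) -
        bigF α ν (joinOver α (ball r k) P)) atTop
      (𝓝 (bigF (autAction β) μ (joinOver (autAction β) (ball r n) fun y : G => (y : G ⧸ N)))) := by
  have hfst : MeasurePreserving Prod.fst (ν.prod μ) ν := measurePreserving_fst
  have hsnd : MeasurePreserving Prod.snd (ν.prod μ) μ := measurePreserving_snd
  have hq : FiniteEntropy μ fun y : G => (y : G ⧸ N) := finiteEntropy_coset N hN
  have hq' := hq.comp_measurePreserving hsnd
  set q : G → G ⧸ N := fun y => y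
  set γ := skewProduct α β σ hσ
  have hA := fun k => hP.joinOver hα (finite_ball r k)
  have hfin : ∀ s : FreeGroup (Fin r), (ball r n ∪ (s * ·) '' ball r n).Finite := fun s =>
    (finite_ball r n).union ((finite_ball r n).image _)
  -- Stated for any base partitions refining P^{B(k)}, so as to cover both P^{B(k)} with window B(n)
  -- and P^{B(k)} ∨ s_i P^{B(k)} with window B(n) ∪ s_i B(n).
  have hsqueeze : ∀ {W : Set (FreeGroup (Fin r))} (_ : W.Finite) {κ : ℕ → Type _}
      [∀ k, Countable (κ k)] (A : ∀ k, X → κ k) (_ : ∀ k, FiniteEntropy ν (A k))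
      (_ : ∀ k, (joinOver α (ball r k) P).FactorsThrough (A k)),
      Tendsto (fun k => shannon (ν.prod μ) (join (A k ∘ Prod.fst) (joinOver γ W (q ∘ Prod.snd))) -
        shannon ν (A k)) atTop (𝓝 (shannon μ (joinOver (autAction β) W q))) := by
    intro W hW κ _ A hAk hfac
    have hWf := hW.to_subtype
    have hc : FiniteEntropy ν (cocycleCosets σ N W) := finiteEntropy_cocycleCosets hσ N hN hW
    have hlim := (tendsto_relShannon_joinOver hα hg hP hc).const_add
      (shannon μ (joinOver (autAction β) W q))
    rw [add_zero] at hlim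
    refine tendsto_of_tendsto_of_tendsto_of_le_of_le tendsto_const_nhds hlim (fun k => ?_)
      fun k => ?_
    · have := (shannon_skewProduct_bounds hσ N hN hγ hβ (hAk k) hW).1
      simp only
      linarith
    · have h1 := (shannon_skewProduct_bounds hσ N hN hγ hβ (hAk k) hW).2
      have h2 := relShannon_anti hc (hAk k) (hfac k)
      simp only
      linarith
  have hmain := hsqueeze (finite_ball r n) (fun k => joinOver α (ball r k) P) hA fun k => .rfl
  have hterm := fun i : Fin r => hsqueeze (hfin (FreeGroup.of i))
    (fun k => join (joinOver α (ball r k) P)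
      (translate α (FreeGroup.of i) (joinOver α (ball r k) P)))
    (fun k => (hA k).join ((hA k).translate hα _)) fun k => factorsThrough_join_left .rfl _
  have hlim := (hmain.const_mul (1 - 2 * (r : ℝ))).add
    (tendsto_finsetSum Finset.univ fun i _ => hterm i)
  have hlimval : bigF (autAction β) μ (joinOver (autAction β) (ball r n) q) =
      (1 - 2 * (r : ℝ)) * shannon μ (joinOver (autAction β) (ball r n) q) +
      ∑ i : Fin r, shannon μ (joinOver (autAction β)
        (ball r n ∪ (FreeGroup.of i * ·) '' ball r n) q) := by
    rw [bigF_eq]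
    congr 1
    refine Finset.sum_congr rfl fun i _ => ?_
    have := (hfin (FreeGroup.of i)).to_subtype
    exact shannon_congr (hq.joinOver hβ (hfin _))
      (join_translate_joinOver_factorsThrough _ _ _ _)
      (factorsThrough_join_translate_joinOver _ _ _ _)
  rw [hlimval]
  refine hlim.congr fun k => ?_
  have hpair : ∀ i : Fin r, shannon (ν.prod μ) (join
      (join (joinOver γ (ball r k) (P ∘ Prod.fst)) (joinOver γ (ball r n) (q ∘ Prod.snd)))
      (translate γ (FreeGroup.of i) (join (joinOver γ (ball r k) (P ∘ Prod.fst))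
        (joinOver γ (ball r n) (q ∘ Prod.snd))))) =
      shannon (ν.prod μ) (join (join (joinOver α (ball r k) P)
        (translate α (FreeGroup.of i) (joinOver α (ball r k) P)) ∘ Prod.fst)
        (joinOver γ (ball r n ∪ (FreeGroup.of i * ·) '' ball r n) (q ∘ Prod.snd))) := fun i => by
    have := (hfin (FreeGroup.of i)).to_subtype
    have e : join (joinOver α (ball r k) P)
        (translate α (FreeGroup.of i) (joinOver α (ball r k) P)) ∘ (Prod.fst : X × G → X) =
        join (joinOver γ (ball r k) (P ∘ Prod.fst))
          (translate γ (FreeGroup.of i) (joinOver γ (ball r k) (P ∘ Prod.fst))) := by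
      rw [joinOver_skewProduct_fst, translate_skewProduct_fst]
      rfl
    have hAk := (hP.comp_measurePreserving hfst).joinOver hγ (finite_ball r k)
    rw [e]
    have hT1 := join_translate_joinOver_factorsThrough γ (ball r n) (FreeGroup.of i)
      (q ∘ Prod.snd)
    have hT2 := factorsThrough_join_translate_joinOver γ (ball r n) (FreeGroup.of i)
      (q ∘ Prod.snd)
    refine shannon_congr ((hAk.join (hAk.translate hγ _)).join (hq'.joinOver hγ (hfin _)))
      (fun x y hxy => ?_) fun x y hxy => ?_
    · simp only [join, translate_join, Prod.mk.injEq] at hxy ⊢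
      have := hT1 hxy.2
      simp only [join, Prod.mk.injEq] at this
      tauto
    · simp only [join, translate_join, Prod.mk.injEq] at hxy ⊢
      exact ⟨⟨hxy.1.1, hxy.2.1⟩, hT2 (Prod.ext hxy.1.2 hxy.2.2)⟩
  rw [bigF_eq, bigF_eq, Finset.sum_congr rfl fun i _ => hpair i, Finset.sum_sub_distrib,
    joinOver_skewProduct_fst]
  ring

theorem smallF_skewProduct {P : X → ι} (hg : IsGenerating α ν P) (hP : FiniteEntropy ν P) :
    smallF (skewProduct α β σ hσ) (ν.prod μ)
      (join (P ∘ Prod.fst) ((fun y : G => (y : G ⧸ N)) ∘ Prod.snd)) =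
      smallF α ν P + smallF (autAction β) μ fun y : G => (y : G ⧸ N) := by
  have hfst : MeasurePreserving Prod.fst (ν.prod μ) ν := measurePreserving_fst
  have hsnd : MeasurePreserving Prod.snd (ν.prod μ) μ := measurePreserving_snd
  have hq : FiniteEntropy μ fun y : G => (y : G ⧸ N) := finiteEntropy_coset N hN
  have hlim := tendsto_bigF_skewProduct_sub hσ N hN hα hβ hγ hg hP
  have hq' := hq.comp_measurePreserving hsnd
  have hP' := hP.comp_measurePreserving hfst
  set q : G → G ⧸ N := fun y => y
  set γ := skewProduct α β σ hσ
  have hA := fun k => hP'.joinOver hγ (finite_ball r k)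
  have hB := fun k => hq'.joinOver hγ (finite_ball r k)
  set A := fun k => joinOver γ (ball r k) (P ∘ Prod.fst)
  set B := fun k => joinOver γ (ball r k) (q ∘ Prod.snd)
  have hcomm : ∀ k n, bigF γ (ν.prod μ) (join (A k) (B n)) =
      bigF γ (ν.prod μ) (join (B n) (A k)) := fun k n =>
    bigF_congr hγ ((hB n).join (hA k))
      (join_factorsThrough (factorsThrough_join_right .rfl _) (factorsThrough_join_left .rfl _))
      (join_factorsThrough (factorsThrough_join_right .rfl _) (factorsThrough_join_left .rfl _))
  have hanti₁ : ∀ n, Antitone fun k => bigF γ (ν.prod μ) (join (A k) (B n)) := fun n =>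
    antitone_bigF_join_joinOver hγ hP' (hB n)
  have hanti₂ : ∀ k, Antitone fun n => bigF γ (ν.prod μ) (join (A k) (B n)) := fun k => by
    simp_rw [hcomm]
    exact antitone_bigF_join_joinOver hγ hq' (hA k)
  have hdiag : ∀ n, bigF γ (ν.prod μ) (joinOver γ (ball r n) (join (P ∘ Prod.fst) (q ∘ Prod.snd))) =
      bigF γ (ν.prod μ) (join (A n) (B n)) := fun n => by
    refine bigF_congr hγ ((hA n).join (hB n)) (joinOver_factorsThrough γ fun w hw => ?_)
      (join_factorsThrough (joinOver_factorsThrough γ fun w hw => ?_)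
        (joinOver_factorsThrough γ fun w hw => ?_))
    · exact join_factorsThrough (factorsThrough_join_left (factorsThrough_joinOver γ hw _) _)
        (factorsThrough_join_right (factorsThrough_joinOver γ hw _) _)
    · exact fun x y hxy => (Prod.ext_iff.1 (factorsThrough_joinOver γ hw _ hxy)).1
    · exact fun x y hxy => (Prod.ext_iff.1 (factorsThrough_joinOver γ hw _ hxy)).2
  have hinner : ∀ n, ⨅ k, (bigF γ (ν.prod μ) (join (A k) (B n)) : EReal) =
      smallF α ν P + (bigF (autAction β) μ (joinOver (autAction β) (ball r n) q) : EReal) :=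
    fun n => by
      rw [smallF_eq_iInf hα hP]
      exact iInf_coe_eq_add_of_tendsto_sub (hanti₁ n) (antitone_bigF_joinOver hα hP) (hlim n)
  rw [smallF_eq_iInf hγ (hP'.join hq')]
  simp_rw [hdiag]
  -- F is antitone in each index separately, so any pair (k, n) is dominated by the diagonal at max
  -- n k.
  have hdouble : ⨅ n, (bigF γ (ν.prod μ) (join (A n) (B n)) : EReal) =
      ⨅ n, ⨅ k, (bigF γ (ν.prod μ) (join (A k) (B n)) : EReal) := by
    refine le_antisymm (le_iInf₂ fun n k => ?_) (le_iInf fun n => (iInf_le _ n).trans (iInf_le _ n))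
    refine (iInf_le _ (max n k)).trans (EReal.coe_le_coe_iff.2 ?_)
    exact (hanti₁ _ (le_max_right n k)).trans (hanti₂ k (le_max_left n k))
  rw [hdouble]
  simp_rw [hinner]
  rw [smallF_eq_iInf hβ hq]
  have hb : Antitone fun n =>
      (bigF (autAction β) μ (joinOver (autAction β) (ball r n) q) : EReal) :=
    fun _ _ h => EReal.coe_le_coe_iff.2 (antitone_bigF_joinOver hβ hq h)
  -- Either summand may be −∞, but neither is +∞; this is what makes `EReal` addition continuous
  -- there.
  have ha : smallF α ν P ≠ ⊤ := by
    rw [smallF_eq_iInf hα hP]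
    exact ne_top_of_le_ne_top (EReal.coe_ne_top _) (iInf_le _ 0)
  have hb' : ⨅ n, (bigF (autAction β) μ (joinOver (autAction β) (ball r n) q) : EReal) ≠ ⊤ :=
    ne_top_of_le_ne_top (EReal.coe_ne_top _) (iInf_le _ 0)
  have hadd := (EReal.continuousAt_add (p := (smallF α ν P, ⨅ n,
    (bigF (autAction β) μ (joinOver (autAction β) (ball r n) q) : EReal)))
    (Or.inl ha) (Or.inr hb')).tendsto.comp (tendsto_const_nhds.prodMk_nhds (tendsto_atTop_iInf hb))
  exact tendsto_nhds_unique (tendsto_atTop_iInf fun _ _ h => add_le_add_right (hb h) _) hadd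

end SkewF

/-! ### Invariance of Haar measure and of the product measure. -/

section Haar

variable {Γ X G : Type*} [Group Γ] [MeasurableSpace X] [Group G] [TopologicalSpace G]
  [IsTopologicalGroup G] [CompactSpace G] [MeasurableSpace G] [BorelSpace G]
  (μ : Measure G) [μ.IsHaarMeasure] [IsProbabilityMeasure μ]

/-- The image of μ under a topological automorphism is again a Haar probability measure, hence
equals μ by uniqueness. -/
theorem measurePreserving_autAction (β : Γ →* MulAut G) (hβ : ∀ g, Continuous (β g)) (g : Γ) :
    MeasurePreserving (autAction β g) μ μ := by
  have hsymm : Continuous (β g).symm := by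
    have := hβ g⁻¹
    rwa [map_inv] at this
  have h1 : (Measure.map (β g) μ).IsHaarMeasure := MulEquiv.isHaarMeasure_map μ (β g) (hβ g) hsymm
  have h2 : IsProbabilityMeasure (Measure.map (β g) μ) :=
    Measure.isProbabilityMeasure_map (hβ g).measurable.aemeasurable
  exact ⟨(hβ g).measurable,
    Measure.isHaarMeasure_eq_of_isProbabilityMeasure (Measure.map (β g) μ) μ⟩

/-- Compact groups are unimodular: right translation commutes with left translations, so the image
is a Haar probability measure and uniqueness applies. -/
theorem map_mul_right_eq_self_of_compactSpace (c : G) : Measure.map (· * c) μ = μ := by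
  have : IsProbabilityMeasure (Measure.map (· * c) μ) :=
    Measure.isProbabilityMeasure_map (measurable_mul_const c).aemeasurable
  exact Measure.isHaarMeasure_eq_of_isProbabilityMeasure _ _

/-- On each fibre the map is an automorphism followed by a right translation, and both preserve μ.
-/
theorem measurePreserving_skewProduct [SecondCountableTopology G] {ν : Measure X}
    [IsProbabilityMeasure ν] {α : Γ →* Equiv.Perm X} (hα : ∀ g, MeasurePreserving (α g) ν ν)
    {β : Γ →* MulAut G} (hβ : ∀ g, Continuous (β g)) {σ : Γ → X → G} (hσ : IsCocycle α β σ)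
    (g : Γ) : MeasurePreserving (skewProduct α β σ hσ g) (ν.prod μ) (ν.prod μ) := by
  refine (hα g).skew_product (g := fun x y => β g y * σ g x) ?_ (Eventually.of_forall fun x => ?_)
  · exact ((hβ g).measurable.comp measurable_snd).mul ((hσ.measurable g).comp measurable_fst)
  · have h : MeasurePreserving (· * σ g x) μ μ :=
      ⟨measurable_mul_const _, map_mul_right_eq_self_of_compactSpace μ _⟩
    exact (h.comp (measurePreserving_autAction μ β hβ g)).map_eq

end Haar

end FInvariant

end

theorem theorem3p2 {r : ℕ}
    {X : Type*} [MeasurableSpace X] [StandardBorelSpace X]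
    (ν : Measure X) [IsProbabilityMeasure ν]
    (α : FreeGroup (Fin r) →* Equiv.Perm X) (hα : ∀ g, MeasurePreserving (α g) ν ν)
    {G : Type*} [Group G] [TopologicalSpace G] [IsTopologicalGroup G] [CompactSpace G]
    [TopologicalSpace.MetrizableSpace G] [TotallyDisconnectedSpace G]
    [MeasurableSpace G] [BorelSpace G]
    (μ : Measure G) [μ.IsHaarMeasure] [IsProbabilityMeasure μ]
    (β : FreeGroup (Fin r) →* MulAut G) (hβ : ∀ g, Continuous (β g))
    (σ : FreeGroup (Fin r) → X → G) (hσ : FInvariant.IsCocycle α β σ)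
    (hN : ∃ N : Subgroup G, N.Normal ∧ N.FiniteIndex ∧ IsClopen (N : Set G) ∧
      FInvariant.IsGenerating (FInvariant.autAction β) μ (fun g : G => (g : G ⧸ N)))
    (hP : ∃ P : X → ℕ, FInvariant.IsFiniteEntropyGenerator α ν P) :
    ∃ a b : EReal,
      FInvariant.HasFInvariant α ν a ∧
      FInvariant.HasFInvariant (FInvariant.autAction β) μ b ∧
      FInvariant.HasFInvariant (FInvariant.skewProduct α β σ hσ) (ν.prod μ) (a + b) := by
  obtain ⟨N, hNn, hNf, -, hq⟩ := hN
  obtain ⟨P, hP, hPe⟩ := hP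
  -- Second countability provides the joint measurability of multiplication needed for the skew
  -- product.
  have : SecondCountableTopology G := by
    let := TopologicalSpace.metrizableSpaceMetric G
    infer_instance
  have hβ' := FInvariant.measurePreserving_autAction μ β hβ
  have hγ := FInvariant.measurePreserving_skewProduct μ hα hβ hσ
  have hqf := FInvariant.finiteEntropy_coset (μ := μ) N hq.measurableSet_cell
  have hPf : FInvariant.FiniteEntropy ν P := ⟨hP.measurableSet_cell, hPe⟩
  refine ⟨_, _, FInvariant.hasFInvariant_smallF hα hP hPe,
    FInvariant.hasFInvariant_smallF hβ' hq hqf.ne_top, ?_⟩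
  rw [← FInvariant.smallF_skewProduct hσ N hq.measurableSet_cell hα hβ' hγ hP hPf]
  exact FInvariant.hasFInvariant_smallF hγ (FInvariant.isGenerating_skewProduct hσ N hP hq)
    ((hPf.comp_measurePreserving measurePreserving_fst).join
      (hqf.comp_measurePreserving measurePreserving_snd)).ne_top
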